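/- \textbf{Setting.} Let $n$ clients minimise $f(u,\mathbf v)=\frac1n\sum_{i=1}^n f_i(u,v_i)$, where $f_i(u,v_i)=\mathbb E_{\xi\sim\mathcal D_i}[F(u,v_i;\xi)]$, $u\in\mathbb R^{d_u}$ and $\mathbf v=(v_1,\dots,v_n)\in(\mathbb R^{d_v})^n$. Assume that $f$ is bounded below, and let $F_0=f(u^0,\mathbf v^0)-\inf f>0$ for the (deterministic) initial point $(u^0,\mathbf v^0)$. \textbf{Assumptions.} (i) Each $f_i$ is differentiable in $u$ and in $v_i$; $\nabla_u f_i$ is $L_u$-Lipschitz in $u$ and $L_{uv}$-Lipschitz in $v_i$; $\nabla_v f_i$ is $L_v$-Lipschitz in $v_i$ and $L_{vu}$-Lipschitz in $u$. Put $L=\max\{L_u,L_v,L_{uv},L_{vu}\}$. (ii) For all $i,u,v_i$ and $\xi_i\sim\mathcal D_i$: $\mathbb E[\nabla_uF(u,v_i;\xi_i)]=\nabla_uf_i(u,v_i)$, $\mathbb E[\nabla_vF(u,v_i;\xi_i)]=\nabla_vf_i(u,v_i)$, $\mathbb E\|\nabla_uF(u,v_i;\xi_i)-\nabla_uf_i(u,v_i)\|^2\le\sigma_u^2$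 and $\mathbb E\|\nabla_vF(u,v_i;\xi_i)-\nabla_vf_i(u,v_i)\|^2\le\sigma_v^2$. (iii) There is $b>0$ such that $\frac1n\sum_{i=1}^n\|\nabla_uf_i(u,v_i)\|^2\le b^2+\|\nabla_uf(u,\mathbf v)\|^2$ for all $u,\mathbf v$. \textbf{Algorithm (FedAvg-P).} Let $1\le m\le n$ and $K,T\ge1$ be integers. In round $t=0,\dots,T-1$ draw a uniformly random set $\mathcal S^t\subseteq\{1,\dots,n\}$ with $|\mathcal S^t|=m$. Each client $i\in\mathcal S^t$ starts from $u_{i,0}^t=u^t$, $v_{i,0}^t=v_i^t$ and performs, for $k=0,\dots,K-1$, the steps $$u_{i,k+1}^t=u_{i,k}^t-\gamma_u\nabla_uF(u_{i,k}^t,v_{i,k}^t;\xi_{i,k}^t),\qquad v_{i,k+1}^t=v_{i,k}^t-\gamma_v\nabla_vF(u_{i,k}^t,v_{i,k}^t;\xi_{i,k}^t),\qquad \xi_{i,k}^t\sim\mathcal D_i;$$ then $v_i^{t+1}=(1-\eta_v)v_i^t+\eta_vv_{i,K}^t$ for $i\in\mathcal S^t$, $v_i^{t+1}=v_i^t$ for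 $i\notin\mathcal S^t$, and $u^{t+1}=(1-\eta_u)u^t+\frac{\eta_u}{m}\sum_{i\in\mathcal S^t}u_{i,K}^t$. All the samples $\xi_{i,k}^t$ and sets $\mathcal S^t$ are mutually independent. \textbf{Claim.} Let $\gamma_u\eta_u=\gamma_v\eta_v=\gamma$ with $$\gamma=\left(32LK+\sqrt{\tfrac{3LKT}{F_0}\Big(\tfrac{4(n-m)Kb^2}{mn}+\tfrac{\sigma_u^2}{m}+\tfrac{m\sigma_v^2}{n}\Big)}\right)^{-1},\qquad \eta_v\ge\sqrt{\tfrac nm},\qquad \eta_u\ge\max\Big(\sqrt m,\sqrt{\tfrac{b^2T}{LF_0}}\Big).$$ Then, with $\mathcal G_u^t=\mathbb E\|\nabla_uf(u^t,\mathbf v^t)\|^2$ and $\hat{\mathcal G}_{\mathbf v}^t=\frac m{n^2}\sum_{i=1}^n\mathbb E\|\nabla_{v}f_i(u^t,v_i^t)\|^2$ (both finite for $0\le t<T$), $$\frac1T\sum_{t=0}^{T-1}\big(\mathcal G_u^t+\hat{\mathcal G}_{\mathbf v}^t\big)\le 8\sqrt{3\Big(\frac{4(n-m)Kb^2}{mn}+\frac{\sigma_u^2}{m}+\frac{m\sigma_v^2}{n}\Big)\frac{LF_0}{KT}}+\frac{129LF_0}{T}.$$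 -/

import Mathlib

open MeasureTheory ProbabilityTheory
open scoped NNReal

noncomputable section

namespace FedAvgP

/-- The Euclidean space `ℝ^d`. -/
abbrev Vec (d : ℕ) : Type := EuclideanSpace ℝ (Fin d)

/-- Partial gradient `∇_u g (u, v)`. -/
def gradU {du dv : ℕ} (g : Vec du → Vec dv → ℝ) (u : Vec du) (v : Vec dv) : Vec du :=
  gradient (fun u' => g u' v) u

/-- Partial gradient `∇_v g (u, v)`. -/
def gradV {du dv : ℕ} (g : Vec du → Vec dv → ℝ) (u : Vec du) (v : Vec dv) : Vec dv :=
  gradient (fun v' => g u v') v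

/-- The objective of one client with data distribution `D`: `E_{ξ ∼ D} F(u, v; ξ)`. -/
def localObj {du dv : ℕ} {Ξ : Type*} [MeasurableSpace Ξ]
    (F : Vec du → Vec dv → Ξ → ℝ) (D : Measure Ξ) (u : Vec du) (v : Vec dv) : ℝ :=
  ∫ x, F u v x ∂D

/-- The global objective `f(u, 𝐯) = (1/n) ∑ i, f_i(u, v_i)`. -/
def globalObj {du dv n : ℕ} {Ξ : Type*} [MeasurableSpace Ξ]
    (F : Vec du → Vec dv → Ξ → ℝ) (D : Fin n → Measure Ξ)
    (u : Vec du) (v : Fin n → Vec dv) : ℝ :=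
  (1 / (n : ℝ)) * ∑ i, localObj F (D i) u (v i)

/-- `∇_u f(u, 𝐯)` for the global objective. -/
def globalGradU {du dv n : ℕ} {Ξ : Type*} [MeasurableSpace Ξ]
    (F : Vec du → Vec dv → Ξ → ℝ) (D : Fin n → Measure Ξ)
    (u : Vec du) (v : Fin n → Vec dv) : Vec du :=
  gradient (fun u' => globalObj F D u' v) u

/-- Initial gap `F₀ = f(u⁰, 𝐯⁰) - inf f` (meaningful when `f` is bounded below). -/
def initialGap {du dv n : ℕ} {Ξ : Type*} [MeasurableSpace Ξ]
    (F : Vec du → Vec dv → Ξ → ℝ) (D : Fin n → Measure Ξ)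
    (u₀ : Vec du) (v₀ : Fin n → Vec dv) : ℝ :=
  globalObj F D u₀ v₀ - ⨅ p : Vec du × (Fin n → Vec dv), globalObj F D p.1 p.2

/-- Smoothness: every `f_i` is differentiable in `u` and in `v`, and its partial gradients are
Lipschitz in each of the two variables separately. -/
structure Smoothness {du dv n : ℕ} {Ξ : Type*} [MeasurableSpace Ξ]
    (F : Vec du → Vec dv → Ξ → ℝ) (D : Fin n → Measure Ξ) (Lu Lv Luv Lvu : ℝ≥0) : Prop where
  differentiable_u : ∀ i v, Differentiable ℝ (fun u => localObj F (D i) u v)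
  differentiable_v : ∀ i u, Differentiable ℝ (fun v => localObj F (D i) u v)
  lipschitz_uu : ∀ i v, LipschitzWith Lu (fun u => gradU (localObj F (D i)) u v)
  lipschitz_uv : ∀ i u, LipschitzWith Luv (fun v => gradU (localObj F (D i)) u v)
  lipschitz_vv : ∀ i u, LipschitzWith Lv (fun v => gradV (localObj F (D i)) u v)
  lipschitz_vu : ∀ i v, LipschitzWith Lvu (fun u => gradV (localObj F (D i)) u v)

/-- Stochastic gradients: `∇_u F(u, v; ξ)` and `∇_v F(u, v; ξ)` exist for almost every `ξ ∼ D_i`,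
depend measurably on `(u, v, ξ)`, are unbiased, and have variance at most `σu²` and `σv²`.
The integrability clauses say that the expectations occurring here, and the one that defines
`f_i`, exist. -/
structure StochasticGradient {du dv n : ℕ} {Ξ : Type*} [MeasurableSpace Ξ]
    (F : Vec du → Vec dv → Ξ → ℝ) (D : Fin n → Measure Ξ) (σu σv : ℝ) : Prop where
  integrable_F : ∀ i u v, Integrable (fun x => F u v x) (D i)
  differentiable_u : ∀ i u v, ∀ᵐ x ∂(D i), DifferentiableAt ℝ (fun u' => F u' v x) u
  differentiable_v : ∀ i u v, ∀ᵐ x ∂(D i), DifferentiableAt ℝ (fun v' => F u v' x) v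
  measurable_u : Measurable (fun p : Vec du × Vec dv × Ξ =>
    gradU (fun u v => F u v p.2.2) p.1 p.2.1)
  measurable_v : Measurable (fun p : Vec du × Vec dv × Ξ =>
    gradV (fun u v => F u v p.2.2) p.1 p.2.1)
  integrable_u : ∀ i u v, Integrable (fun x => gradU (fun u v => F u v x) u v) (D i)
  integrable_v : ∀ i u v, Integrable (fun x => gradV (fun u v => F u v x) u v) (D i)
  unbiased_u : ∀ i u v,
    ∫ x, gradU (fun u v => F u v x) u v ∂(D i) = gradU (localObj F (D i)) u v
  unbiased_v : ∀ i u v,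
    ∫ x, gradV (fun u v => F u v x) u v ∂(D i) = gradV (localObj F (D i)) u v
  integrable_sq_u : ∀ i u v, Integrable
    (fun x => ‖gradU (fun u v => F u v x) u v - gradU (localObj F (D i)) u v‖ ^ 2) (D i)
  integrable_sq_v : ∀ i u v, Integrable
    (fun x => ‖gradV (fun u v => F u v x) u v - gradV (localObj F (D i)) u v‖ ^ 2) (D i)
  variance_u : ∀ i u v,
    ∫ x, ‖gradU (fun u v => F u v x) u v - gradU (localObj F (D i)) u v‖ ^ 2 ∂(D i) ≤ σu ^ 2
  variance_v : ∀ i u v,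
    ∫ x, ‖gradV (fun u v => F u v x) u v - gradV (localObj F (D i)) u v‖ ^ 2 ∂(D i) ≤ σv ^ 2

/-- Bounded gradient dissimilarity with constant `b`. -/
def BoundedDissimilarity {du dv n : ℕ} {Ξ : Type*} [MeasurableSpace Ξ]
    (F : Vec du → Vec dv → Ξ → ℝ) (D : Fin n → Measure Ξ) (b : ℝ) : Prop :=
  ∀ (u : Vec du) (v : Fin n → Vec dv),
    (1 / (n : ℝ)) * ∑ i, ‖gradU (localObj F (D i)) u (v i)‖ ^ 2
      ≤ b ^ 2 + ‖globalGradU F D u v‖ ^ 2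

/-- The randomness of the algorithm: `S t` is a uniformly random set of `m` clients, `ξ t i k` is a
sample with law `D i`, and all the `S t` and `ξ t i k` are mutually independent. -/
structure IsSampling {n : ℕ} {Ξ Ω : Type*} [MeasurableSpace Ξ] [MeasurableSpace Ω]
    (P : Measure Ω) (m : ℕ) (D : Fin n → Measure Ξ)
    (S : ℕ → Ω → Finset (Fin n)) (ξ : ℕ → Fin n → ℕ → Ω → Ξ) : Prop where
  measurable_S : ∀ t, Measurable (S t)
  uniform_S : ∀ t (A : Finset (Fin n)), A.card = m →
    P.real {ω | S t ω = A} = 1 / (n.choose m : ℝ)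
  measurable_ξ : ∀ t i k, Measurable (ξ t i k)
  law_ξ : ∀ t i k, P.map (ξ t i k) = D i
  indep_S : iIndepFun S P
  indep_ξ : iIndepFun (fun p : ℕ × Fin n × ℕ => ξ p.1 p.2.1 p.2.2) P
  indep_S_ξ : IndepFun (fun ω t => S t ω)
    (fun ω (p : ℕ × Fin n × ℕ) => ξ p.1 p.2.1 p.2.2 ω) P

/-- The local iterates `(u_{i,k}, v_{i,k})` of one client, started at `p` and driven by the samples
`x 0, x 1, …`. Both variables are updated simultaneously. -/
def localIter {du dv : ℕ} {Ξ : Type*} (F : Vec du → Vec dv → Ξ → ℝ) (γu γv : ℝ)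
    (x : ℕ → Ξ) (p : Vec du × Vec dv) : ℕ → Vec du × Vec dv
  | 0 => p
  | k + 1 =>
    let q := localIter F γu γv x p k
    (q.1 - γu • gradU (fun u v => F u v (x k)) q.1 q.2,
      q.2 - γv • gradV (fun u v => F u v (x k)) q.1 q.2)

/-- The iterates `(u^t, 𝐯^t)` of FedAvg-P with `K` local steps, for a given realization of the
sampled client sets `S t` and of the data `x t i k`. The clients outside `S t` keep their personal
variable in round `t`. -/
def iter {du dv n : ℕ} {Ξ : Type*} (F : Vec du → Vec dv → Ξ → ℝ) (m K : ℕ) (γu γv ηu ηv : ℝ)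
    (S : ℕ → Finset (Fin n)) (x : ℕ → Fin n → ℕ → Ξ) (u₀ : Vec du) (v₀ : Fin n → Vec dv) :
    ℕ → Vec du × (Fin n → Vec dv)
  | 0 => (u₀, v₀)
  | t + 1 =>
    let s := iter F m K γu γv ηu ηv S x u₀ v₀ t
    let loc : Fin n → Vec du × Vec dv := fun i =>
      localIter F γu γv (x t i) (s.1, s.2 i) K
    ((1 - ηu) • s.1 + (ηu / (m : ℝ)) • ∑ i ∈ S t, (loc i).1,
      fun i => if i ∈ S t then (1 - ηv) • s.2 i + ηv • (loc i).2 else s.2 i)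

end FedAvgP

end

/-! The potential is E f(u^t, v^t) - inf f; a descent inequality for one round is telescoped. Fix
the state at the start of a round and the client set A. Each stochastic gradient is the sum of a
centred noise, a drift (local gradient now minus local gradient at the start of the round) and the
gradient at the start. Since γ_u η_u = γ_v η_v = γ, the round moves u by -(γ/m) ∑_{i ∈ A} (noises +
drifts + K ∇_u f_i), and v_i for i ∈ A by the analogous sum for client i alone. This is inserted
into the quadratic upper bound `Smoothness.globalObj_le`, and three effects are estimated.

Noise. The noises of one round are pairwise orthogonal in L² (`IsNoise.integral_inner_eq_zero`), so
second moments of their sums grow linearly in the number of terms. This produces σ_u²/m and mσ_v²/n.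

Client sampling. On average over all m-subsets, linear terms become m/n times full sums, while ‖∑_{i
∈ A} ∇_u f_i‖² exceeds m²‖∇_u f‖² only by the variance of sampling without replacement
(`sum_powersetCard_norm_sq_sum_le`). This produces (n-m)b²/(mn).

Drift. The drift is bounded in terms of itself (`RoundAssumptions.drift_le`), and 32γLK ≤ 1 closes
the loop. The lower bounds on η_u and η_v make the local steps γ_u, γ_v so small that the drift
costs a fraction of the gradient and variance terms, plus a remainder γK·LF₀/(4T) that pays for b².

With V the variance term and X = ‖∇_u f‖² + (m/n²) ∑ ‖∇_v f_i‖², one round gives E[next potential] +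
(γK/4) X ≤ potential + 3LKγ²V + γK·LF₀/(4T). Fresh randomness in each round
(`IsSampling.indepFun_iter`) allows this to be averaged over the past and summed. Division by γKT/4
and the value of γ⁻¹ give the rate: 129 = 4·32 + 1, and the factor 8 is 4 from γ⁻¹ plus 4 from γV.

Finite expectation of the potential is not known in advance, so the recursion runs in `ENNReal`;
integrability of the gradients comes out of the summed bound. -/

namespace FedAvgP

/-! ### Smooth functions -/

/-- Quadratic upper bound for a function with Lipschitz gradient. -/
theorem le_add_inner_add_of_lipschitzWith_gradient {E : Type*} [NormedAddCommGroup E]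
    [InnerProductSpace ℝ E] [CompleteSpace E] {g : E → ℝ} (hg : Differentiable ℝ g) {L : ℝ≥0}
    (hL : LipschitzWith L (gradient g)) (x y : E) :
    g y ≤ g x + inner ℝ (gradient g x) (y - x) + L / 2 * ‖y - x‖ ^ 2 := by
  set w := y - x with hw
  -- The difference between `g` on the segment and its quadratic bound, up to a constant. Its
  -- derivative is nonpositive by Cauchy–Schwarz and the Lipschitz bound, so φ 1 ≤ φ 0, which is the
  -- claim.
  let φ : ℝ → ℝ := fun s =>
    g (x + s • w) - s * inner ℝ (gradient g x) w - L / 2 * s ^ 2 * ‖w‖ ^ 2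
  have hder : ∀ s, HasDerivAt φ
      (inner ℝ (gradient g (x + s • w)) w - inner ℝ (gradient g x) w - L * s * ‖w‖ ^ 2) s := by
    intro s
    have h1 : HasDerivAt (fun s : ℝ => x + s • w) w s := by
      simpa using ((hasDerivAt_id s).smul_const w).const_add x
    have h2 : HasDerivAt (fun s : ℝ => g (x + s • w)) (inner ℝ (gradient g (x + s • w)) w) s := by
      have := (hg (x + s • w)).hasFDerivAt.comp_hasDerivAt s h1
      rwa [← inner_gradient_left] at this
    have h3 : HasDerivAt (fun s : ℝ => s * inner ℝ (gradient g x) w)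
        (inner ℝ (gradient g x) w) s := by
      simpa using (hasDerivAt_id s).mul_const (inner ℝ (gradient g x) w)
    have h4 : HasDerivAt (fun s : ℝ => L / 2 * s ^ 2 * ‖w‖ ^ 2) (L * s * ‖w‖ ^ 2) s := by
      have := (((hasDerivAt_id s).pow 2).const_mul ((L : ℝ) / 2)).mul_const (‖w‖ ^ 2)
      exact this.congr_deriv (by simp only [id]; push_cast; ring)
    exact (h2.sub h3).sub h4
  have hanti : AntitoneOn φ (Set.Icc 0 1) := by
    refine antitoneOn_of_deriv_nonpos (convex_Icc 0 1)
      (fun s _ => (hder s).continuousAt.continuousWithinAt)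
      (fun s _ => (hder s).differentiableAt.differentiableWithinAt) fun s hs => ?_
    rw [interior_Icc] at hs
    rw [(hder s).deriv, ← inner_sub_left]
    have h1 := real_inner_le_norm (gradient g (x + s • w) - gradient g x) w
    have h2 : ‖gradient g (x + s • w) - gradient g x‖ ≤ L * (s * ‖w‖) := by
      have := hL.norm_sub_le (x + s • w) x
      rwa [add_sub_cancel_left, norm_smul, Real.norm_of_nonneg hs.1.le] at this
    nlinarith [mul_le_mul_of_nonneg_right h2 (norm_nonneg w)]
  have h := hanti (Set.left_mem_Icc.2 zero_le_one) (Set.right_mem_Icc.2 zero_le_one) zero_le_one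
  simp only [φ, one_smul, zero_smul, add_zero] at h
  rw [show x + w = y by simp [hw]] at h
  linarith

/-! ### Stochastic noise -/

section Noise

variable {α Ξ Ω E : Type*} [MeasurableSpace α] [MeasurableSpace Ξ] [MeasurableSpace Ω]
  [NormedAddCommGroup E] [MeasurableSpace E] [BorelSpace E] [SecondCountableTopology E]
  {P : Measure Ω} [IsProbabilityMeasure P] {D : Measure Ξ}
  {Y : Ω → α} {Z : Ω → Ξ} {h : α × Ξ → E}

/-- Independence makes the joint law a product, so Tonelli applies. Freezing the first variable
takes the place of a conditional expectation throughout. -/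
theorem lintegral_comp_of_indepFun (hY : Measurable Y) (hZ : Measurable Z)
    (hYZ : IndepFun Y Z P) {φ : α × Ξ → ENNReal} (hφ : Measurable φ) :
    ∫⁻ ω, φ (Y ω, Z ω) ∂P = ∫⁻ ω, ∫⁻ ω', φ (Y ω, Z ω') ∂P ∂P := by
  have hmap := (indepFun_iff_map_prod_eq_prod_map_map hY.aemeasurable hZ.aemeasurable).1 hYZ
  have := Measure.isProbabilityMeasure_map hZ.aemeasurable (μ := P)
  calc ∫⁻ ω, φ (Y ω, Z ω) ∂P = ∫⁻ p, φ p ∂(P.map fun ω => (Y ω, Z ω)) :=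
        (lintegral_map hφ (hY.prodMk hZ)).symm
    _ = ∫⁻ y, ∫⁻ z, φ (y, z) ∂(P.map Z) ∂(P.map Y) := by
        rw [hmap, lintegral_prod _ hφ.aemeasurable]
    _ = ∫⁻ ω, ∫⁻ z, φ (Y ω, z) ∂(P.map Z) ∂P :=
        lintegral_map hφ.lintegral_prod_right' hY
    _ = _ := by
        refine lintegral_congr fun ω => lintegral_map (hφ.comp measurable_prodMk_left) hZ

/-- With `Y` frozen the second moment is at most `s` by assumption, and averaging over `Y` preserves
the bound. The estimate is first made for lower integrals because square integrability is part of
the conclusion. -/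
theorem memLp_noise (hh : Measurable h) (hY : Measurable Y) (hZ : Measurable Z)
    (hlaw : P.map Z = D) (hYZ : IndepFun Y Z P) {s : ℝ}
    (hint : ∀ y, Integrable (fun x => ‖h (y, x)‖ ^ 2) D)
    (hvar : ∀ y, ∫ x, ‖h (y, x)‖ ^ 2 ∂D ≤ s) :
    MemLp (fun ω => h (Y ω, Z ω)) 2 P ∧ ∫ ω, ‖h (Y ω, Z ω)‖ ^ 2 ∂P ≤ s := by
  have hs : 0 ≤ s := by
    obtain ⟨ω⟩ := P.nonempty_of_neZero
    exact (integral_nonneg fun _ => by positivity).trans (hvar (Y ω))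
  have hm : Measurable fun ω => h (Y ω, Z ω) := hh.comp (hY.prodMk hZ)
  have hle : ∫⁻ ω, ENNReal.ofReal (‖h (Y ω, Z ω)‖ ^ 2) ∂P ≤ ENNReal.ofReal s := by
    rw [lintegral_comp_of_indepFun hY hZ hYZ (φ := fun p => ENNReal.ofReal (‖h p‖ ^ 2))
      (hh.norm.pow_const 2).ennreal_ofReal]
    calc _ ≤ ∫⁻ _, ENNReal.ofReal s ∂P := by
          refine lintegral_mono fun ω => ?_
          have : ∫⁻ ω', ENNReal.ofReal (‖h (Y ω, Z ω')‖ ^ 2) ∂P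
              = ∫⁻ x, ENNReal.ofReal (‖h (Y ω, x)‖ ^ 2) ∂D := by
            rw [← hlaw]
            exact (lintegral_map (((hh.comp measurable_prodMk_left).norm.pow_const
              2).ennreal_ofReal) hZ).symm
          dsimp only
          rw [this, ← ofReal_integral_eq_lintegral_ofReal (hint _)
            (Filter.Eventually.of_forall fun _ => by positivity)]
          exact ENNReal.ofReal_le_ofReal (hvar _)
      _ = ENNReal.ofReal s := by simp
  have hi : Integrable (fun ω => ‖h (Y ω, Z ω)‖ ^ 2) P := by
    refine ⟨(hm.norm.pow_const 2).aestronglyMeasurable, ?_⟩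
    rw [hasFiniteIntegral_iff_ofReal (Filter.Eventually.of_forall fun _ => by positivity)]
    exact hle.trans_lt ENNReal.ofReal_lt_top
  refine ⟨(memLp_two_iff_integrable_sq_norm hm.aestronglyMeasurable).2 hi, ?_⟩
  rw [integral_eq_lintegral_of_nonneg_ae (Filter.Eventually.of_forall fun _ => by positivity)
    hi.aestronglyMeasurable]
  exact ENNReal.toReal_le_of_le_ofReal hs hle

/-- The martingale-difference property: with `Y` frozen, `w (Y)` is a constant vector and the noise
integrates to zero against it. Fubini is legitimate since both factors are in L². -/
theorem integral_inner_noise [InnerProductSpace ℝ E] [CompleteSpace E] [IsProbabilityMeasure D]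
    (hh : Measurable h) (hY : Measurable Y) (hZ : Measurable Z)
    (hlaw : P.map Z = D) (hYZ : IndepFun Y Z P)
    (hint : ∀ y, Integrable (fun x => h (y, x)) D) (hmean : ∀ y, ∫ x, h (y, x) ∂D = 0)
    {w : α → E} (hw : Measurable w) (hwL : MemLp (fun ω => w (Y ω)) 2 P)
    (hL : MemLp (fun ω => h (Y ω, Z ω)) 2 P) :
    ∫ ω, inner ℝ (w (Y ω)) (h (Y ω, Z ω)) ∂P = 0 := by
  have hmap := (indepFun_iff_map_prod_eq_prod_map_map hY.aemeasurable hZ.aemeasurable).1 hYZ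
  have hpY := Measure.isProbabilityMeasure_map hY.aemeasurable (μ := P)
  have hφ : Measurable fun p : α × Ξ => (inner ℝ (w p.1) (h p) : ℝ) :=
    (hw.comp measurable_fst).inner hh
  have hi : Integrable (fun ω => (inner ℝ (w (Y ω)) (h (Y ω, Z ω)) : ℝ)) P := by
    refine (hwL.norm.integrable_mul hL.norm).mono' (hφ.comp (hY.prodMk hZ)).aestronglyMeasurable
      (Filter.Eventually.of_forall fun ω => ?_)
    exact norm_inner_le_norm _ _
  have hi' : Integrable (fun p : α × Ξ => (inner ℝ (w p.1) (h p) : ℝ)) ((P.map Y).prod D) := by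
    rw [← hlaw, ← hmap, integrable_map_measure hφ.aestronglyMeasurable
      (hY.prodMk hZ).aemeasurable]
    exact hi
  calc ∫ ω, inner ℝ (w (Y ω)) (h (Y ω, Z ω)) ∂P
      = ∫ p, inner ℝ (w p.1) (h p) ∂(P.map fun ω => (Y ω, Z ω)) :=
        (integral_map (hY.prodMk hZ).aemeasurable hφ.aestronglyMeasurable).symm
    _ = ∫ y, ∫ x, inner ℝ (w y) (h (y, x)) ∂D ∂(P.map Y) := by
        rw [hmap, hlaw, integral_prod _ hi']
    _ = 0 := by
        simp_rw [integral_inner (hint _), hmean, inner_zero_right, integral_zero]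

end Noise

/-! ### Independence -/

section Independence

variable {Ω A B C : Type*} [MeasurableSpace Ω] [MeasurableSpace A] [MeasurableSpace B]
  [MeasurableSpace C] {P : Measure Ω} [IsProbabilityMeasure P]

/-- The hypotheses say that the law of the triple is a product of three laws; reassociating the
product regroups the variables. -/
theorem indepFun_prodMk_of_indepFun {X : Ω → A} {Y : Ω → B} {Z : Ω → C} (hX : Measurable X)
    (hY : Measurable Y) (hZ : Measurable Z) (hXY : IndepFun X Y P)
    (hXYZ : IndepFun (fun ω => (X ω, Y ω)) Z P) :
    IndepFun X (fun ω => (Y ω, Z ω)) P := by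
  have hYZ : IndepFun Y Z P := hXYZ.comp (φ := Prod.snd) (ψ := id) measurable_snd measurable_id
  have := Measure.isProbabilityMeasure_map hX.aemeasurable (μ := P)
  have := Measure.isProbabilityMeasure_map hY.aemeasurable (μ := P)
  have := Measure.isProbabilityMeasure_map hZ.aemeasurable (μ := P)
  rw [indepFun_iff_map_prod_eq_prod_map_map hX.aemeasurable (hY.prodMk hZ).aemeasurable,
    (indepFun_iff_map_prod_eq_prod_map_map hY.aemeasurable hZ.aemeasurable).1 hYZ]
  have h1 := (indepFun_iff_map_prod_eq_prod_map_map (hX.prodMk hY).aemeasurable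
    hZ.aemeasurable).1 hXYZ
  rw [(indepFun_iff_map_prod_eq_prod_map_map hX.aemeasurable hY.aemeasurable).1 hXY] at h1
  rw [← Measure.prodAssoc_prod, ← h1, Measure.map_map (by fun_prop) (by fun_prop)]
  rfl

/-- Averaging over a discrete random variable that is independent of the rest. -/
theorem lintegral_comp_finset_of_indepFun {n : ℕ} {S : Ω → Finset (Fin n)} {Y : Ω → B}
    (hS : Measurable S) (hY : Measurable Y) (hSY : IndepFun S Y P)
    {φ : Finset (Fin n) → B → ENNReal} (hφ : ∀ s, Measurable (φ s)) :
    ∫⁻ ω, φ (S ω) (Y ω) ∂P = ∑ s, P {ω | S ω = s} * ∫⁻ ω, φ s (Y ω) ∂P := by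
  have hmeas : Measurable fun p : B × Finset (Fin n) => φ p.2 p.1 :=
    measurable_from_prod_countable_left hφ
  rw [lintegral_comp_of_indepFun hY hS hSY.symm hmeas]
  have : ∀ ω, ∫⁻ ω', φ (S ω') (Y ω) ∂P = ∑ s, P {ω | S ω = s} * φ s (Y ω) := by
    intro ω
    have h1 := lintegral_map (μ := P) (f := fun s => φ s (Y ω)) (measurable_of_finite _) hS
    rw [← h1, lintegral_fintype]
    refine Finset.sum_congr rfl fun s _ => ?_
    rw [Measure.map_apply hS (measurableSet_singleton s), mul_comm]
    rfl
  simp only [this]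
  rw [lintegral_finsetSum _ fun s _ => by exact ((hφ s).comp hY).const_mul _]
  refine Finset.sum_congr rfl fun s _ => ?_
  exact lintegral_const_mul _ ((hφ s).comp hY)

end Independence

/-! ### Averages over subsets of a fixed size -/

section Subsets

open Finset

/-- Double counting: each index belongs to a fraction m/n of the m-subsets. -/
theorem sum_powersetCard_sum {n m : ℕ} (hm : 1 ≤ m) (hmn : m ≤ n) (c : Fin n → ℝ) :
    ∑ s ∈ powersetCard m univ, ∑ i ∈ s, c i = n.choose m * ((m : ℝ) / n) * ∑ i, c i := by
  have hn : (n : ℝ) ≠ 0 := by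
    have : 0 < n := hm.trans hmn
    positivity
  have hcard : ∀ i : Fin n, (#{s ∈ powersetCard m (univ : Finset (Fin n)) | i ∈ s} : ℝ)
      = n.choose m * ((m : ℝ) / n) := by
    intro i
    have h1 := card_filter_powersetCard_subset {i} (univ : Finset (Fin n)) m (subset_univ _)
      (by simpa using hm)
    simp only [singleton_subset_iff, card_singleton, card_univ, Fintype.card_fin] at h1
    rw [h1]
    obtain ⟨m, rfl⟩ := Nat.exists_eq_add_of_le' hm
    obtain ⟨n, rfl⟩ := Nat.exists_eq_add_of_le' (hm.trans hmn)
    have h2 : ((n : ℝ) + 1) * n.choose m = (n + 1).choose (m + 1) * (m + 1) := by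
      exact_mod_cast Nat.add_one_mul_choose_eq n m
    simp only [Nat.add_sub_cancel]
    push_cast at hn ⊢
    field_simp
    linarith
  calc _ = ∑ s ∈ powersetCard m univ, ∑ i, if i ∈ s then c i else 0 := by
        simp
    _ = ∑ i, (#{s ∈ powersetCard m (univ : Finset (Fin n)) | i ∈ s} : ℝ) * c i := by
        rw [sum_comm]
        refine sum_congr rfl fun i _ => ?_
        rw [← sum_filter, sum_const, nsmul_eq_mul]
    _ = _ := by
        simp_rw [hcard, mul_sum]

/-- Inclusion probability m(m-1)/(n(n-1)) of a pair under sampling without replacement. The case m =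
1 is separate because the general count requires subsets that can contain the pair. -/
theorem card_powersetCard_filter_pair {n m : ℕ} (hm : 1 ≤ m) (hmn : m ≤ n) {i j : Fin n}
    (hij : i ≠ j) :
    (#{s ∈ powersetCard m (univ : Finset (Fin n)) | i ∈ s ∧ j ∈ s} : ℝ) * (n * (n - 1))
      = n.choose m * (m * (m - 1)) := by
  rcases Nat.lt_or_ge m 2 with h | hm2
  · obtain rfl : m = 1 := by omega
    have : ({s ∈ powersetCard 1 (univ : Finset (Fin n)) | i ∈ s ∧ j ∈ s}) = ∅ := by
      refine filter_eq_empty_iff.2 fun s hs h => hij ?_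
      exact card_le_one.1 (mem_powersetCard.1 hs).2.le i h.1 j h.2
    rw [this]
    simp
  · have h1 := card_filter_powersetCard_subset {i, j} (univ : Finset (Fin n)) m (subset_univ _)
      (by rwa [card_pair hij])
    simp only [insert_subset_iff, singleton_subset_iff, card_pair hij, card_univ,
      Fintype.card_fin] at h1
    rw [h1]
    obtain ⟨m, rfl⟩ := Nat.exists_eq_add_of_le' hm2
    obtain ⟨n, rfl⟩ := Nat.exists_eq_add_of_le' (hm2.trans hmn)
    have h2 : ((n : ℝ) + 1) * n.choose m = (n + 1).choose (m + 1) * (m + 1) := by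
      exact_mod_cast Nat.add_one_mul_choose_eq n m
    have h3 : ((n : ℝ) + 2) * (n + 1).choose (m + 1)
        = (n + 2).choose (m + 2) * (m + 2) := by
      exact_mod_cast Nat.add_one_mul_choose_eq (n + 1) (m + 1)
    simp only [Nat.add_sub_cancel]
    push_cast
    linear_combination ((n : ℝ) + 2) * h2 + ((m : ℝ) + 1) * h3

variable {E : Type*} [NormedAddCommGroup E] [InnerProductSpace ℝ E]

/-- Expanding the square weights each ⟨a_i, a_j⟩ by the number of m-subsets containing i and j. Up
to the factor n(n-1) this weight is a constant plus a diagonal excess proportional to m(n-1) -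
m(m-1) = m(n-m). The constant part multiplies ‖∑ a_i‖² = 0, so only the diagonal survives. The
multiplied-out form keeps n = 1 admissible. -/
theorem sum_powersetCard_norm_sq_sum_of_sum_eq_zero {n m : ℕ} (hm : 1 ≤ m) (hmn : m ≤ n)
    (a : Fin n → E) (ha : ∑ i, a i = 0) :
    (∑ s ∈ powersetCard m univ, ‖∑ i ∈ s, a i‖ ^ 2) * (n * (n - 1))
      = n.choose m * (m * (n - m)) * ∑ i, ‖a i‖ ^ 2 := by
  set N : Fin n → Fin n → ℝ :=
    fun i j => #{s ∈ powersetCard m (univ : Finset (Fin n)) | i ∈ s ∧ j ∈ s} with hN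
  have h1 : ∑ s ∈ powersetCard m (univ : Finset (Fin n)), ‖∑ i ∈ s, a i‖ ^ 2
      = ∑ i, ∑ j, N i j * inner ℝ (a i) (a j) := by
    calc _ = ∑ s ∈ powersetCard m (univ : Finset (Fin n)), ∑ i, ∑ j,
          if i ∈ s ∧ j ∈ s then inner ℝ (a i) (a j) else 0 := by
          refine sum_congr rfl fun s _ => ?_
          rw [← real_inner_self_eq_norm_sq, sum_inner]
          simp only [inner_sum, ite_and]
          have h : ∀ i, (∑ j, if i ∈ s then if j ∈ s then (inner ℝ (a i) (a j) : ℝ) else 0 else 0)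
              = if i ∈ s then ∑ j ∈ s, inner ℝ (a i) (a j) else 0 := by
            intro i
            split_ifs <;> simp
          simp [h]
      _ = _ := by
          rw [sum_comm]
          refine sum_congr rfl fun i _ => ?_
          rw [sum_comm]
          refine sum_congr rfl fun j _ => ?_
          rw [← sum_filter, sum_const, nsmul_eq_mul]
  have hn : (1 : ℝ) ≤ n := by exact_mod_cast hm.trans hmn
  have hdiag : ∀ i, N i i * (n * (n - 1)) = n.choose m * (m * (n - 1)) := by
    intro i
    have := sum_powersetCard_sum hm hmn (fun j => if j = i then (1 : ℝ) else 0)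
    have hi : N i i = n.choose m * ((m : ℝ) / n) := by
      simpa [hN, ← sum_filter] using this
    rw [hi]
    field_simp
  have h2 : ∀ i j, N i j * (n * (n - 1))
      = n.choose m * (m * (m - 1)) + if i = j then n.choose m * (m * (n - m) : ℝ) else 0 := by
    intro i j
    split_ifs with hij
    · subst hij
      rw [hdiag]
      ring
    · rw [add_zero]
      exact card_powersetCard_filter_pair hm hmn hij
  rw [h1, sum_mul]
  have h3 : ∀ i, (∑ j, N i j * inner ℝ (a i) (a j)) * ((n : ℝ) * (n - 1))
      = n.choose m * (m * (n - m)) * ‖a i‖ ^ 2 := by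
    intro i
    have : ∀ j, N i j * inner ℝ (a i) (a j) * ((n : ℝ) * (n - 1))
        = n.choose m * (m * (m - 1)) * inner ℝ (a i) (a j)
          + if i = j then n.choose m * (m * (n - m)) * inner ℝ (a i) (a j) else 0 := by
      intro j
      rw [mul_right_comm, h2]
      split_ifs <;> ring
    rw [sum_mul]
    simp_rw [this]
    rw [sum_add_distrib, ← mul_sum, ← inner_sum, ha]
    simp
  simp_rw [h3, mul_sum]

/-- Second moment of the sum over a uniformly random subset, for vectors with bounded
dissimilarity. -/
theorem sum_powersetCard_norm_sq_sum_le {n m : ℕ} (hm : 1 ≤ m) (hmn : m ≤ n)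
    (g : Fin n → E) (gbar : E) (hg : gbar = (1 / (n : ℝ)) • ∑ i, g i) {b : ℝ}
    (hb : (1 / (n : ℝ)) * ∑ i, ‖g i‖ ^ 2 ≤ b ^ 2 + ‖gbar‖ ^ 2) :
    ∑ s ∈ powersetCard m univ, ‖∑ i ∈ s, g i‖ ^ 2
      ≤ n.choose m * (m ^ 2 * ‖gbar‖ ^ 2 + 2 * (m * (n - m) / n) * b ^ 2) := by
  have hn : (1 : ℝ) ≤ n := by exact_mod_cast hm.trans hmn
  have hmn' : (m : ℝ) ≤ n := by exact_mod_cast hmn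
  have hm' : (1 : ℝ) ≤ m := by exact_mod_cast hm
  have hsum : ∑ i, g i = (n : ℝ) • gbar := by
    rw [hg, smul_smul, mul_one_div_cancel (by positivity), one_smul]
  -- Centring: the mean contributes m²‖gbar‖², the cross terms cancel over all subsets, and bounded
  -- dissimilarity says that the centred vectors have mean square at most b².
  set a : Fin n → E := fun i => g i - gbar with ha
  have ha0 : ∑ i, a i = 0 := by
    simp [ha, hsum, ← Nat.cast_smul_eq_nsmul ℝ]
  have hasq : ∑ i, ‖a i‖ ^ 2 ≤ n * b ^ 2 := by
    have h1 : ∀ i, ‖a i‖ ^ 2 = ‖g i‖ ^ 2 - 2 * inner ℝ (g i) gbar + ‖gbar‖ ^ 2 :=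
      fun i => norm_sub_sq_real _ _
    have h2 : ∑ i, ‖a i‖ ^ 2 = ∑ i, ‖g i‖ ^ 2 - n * ‖gbar‖ ^ 2 := by
      simp_rw [h1]
      rw [sum_add_distrib, sum_sub_distrib, ← mul_sum, ← sum_inner, hsum,
        real_inner_smul_left, real_inner_self_eq_norm_sq]
      simp
      ring
    rw [one_div, inv_mul_le_iff₀ (by positivity)] at hb
    rw [h2]
    linarith
  have hexp : ∀ s ∈ powersetCard m (univ : Finset (Fin n)), ‖∑ i ∈ s, g i‖ ^ 2
      = m ^ 2 * ‖gbar‖ ^ 2 + ∑ i ∈ s, 2 * m * inner ℝ gbar (a i) + ‖∑ i ∈ s, a i‖ ^ 2 := by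
    intro s hs
    have h1 : ∑ i ∈ s, g i = (m : ℝ) • gbar + ∑ i ∈ s, a i := by
      simp [ha, (mem_powersetCard.1 hs).2, ← Nat.cast_smul_eq_nsmul ℝ]
    rw [h1, norm_add_sq_real, norm_smul, mul_pow, real_inner_smul_left, inner_sum, ← mul_sum]
    simp
    ring
  rw [sum_congr rfl hexp, sum_add_distrib, sum_add_distrib, sum_powersetCard_sum hm hmn,
    ← mul_sum univ, ← inner_sum, ha0]
  simp only [sum_const, card_powersetCard, card_univ, Fintype.card_fin, nsmul_eq_mul,
    inner_zero_right, mul_zero, add_zero, mul_add]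
  gcongr
  have key := sum_powersetCard_norm_sq_sum_of_sum_eq_zero hm hmn a ha0
  rcases (hm.trans hmn).eq_or_lt with h1 | h1
  · obtain rfl : n = 1 := h1.symm
    obtain rfl : m = 1 := by omega
    have : ∀ i : Fin 1, a i = 0 := fun i => by
      rw [← ha0, Fin.sum_univ_one, Subsingleton.elim i 0]
    simp [this]
  · have hn2 : (2 : ℝ) ≤ n := by exact_mod_cast h1
    have hpos : (0 : ℝ) < n * (n - 1) := by nlinarith
    rw [← mul_le_mul_iff_left₀ hpos, key]
    calc (n.choose m : ℝ) * (m * (n - m)) * ∑ i, ‖a i‖ ^ 2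
        ≤ n.choose m * (m * (n - m)) * (n * b ^ 2) := by
          have : (0 : ℝ) ≤ n - m := by linarith
          gcongr
      -- The exact variance factor n/(n-1) is replaced by 2, which is where the 2 in the statement
      -- comes from. It requires n ≥ 2; for n = 1 the centred vector is zero.
      _ ≤ n.choose m * (m * (n - m)) * (2 * (n - 1) * b ^ 2) := by
          have : (0 : ℝ) ≤ n - m := by linarith
          gcongr
          linarith
      _ = _ := by
          field_simp

end Subsets

/-! ### Functions that are Lipschitz in each of two variables -/

section Lipschitz

variable {A B E : Type*} [NormedAddCommGroup A] [NormedAddCommGroup B] [NormedAddCommGroup E]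
  {G : A → B → E} {K₁ K₂ : ℝ≥0} {L : ℝ}

theorem norm_sub_le_of_lipschitzWith (h₁ : ∀ b, LipschitzWith K₁ fun a => G a b)
    (h₂ : ∀ a, LipschitzWith K₂ (G a)) (hK₁ : (K₁ : ℝ) ≤ L) (hK₂ : (K₂ : ℝ) ≤ L)
    (a a' : A) (b b' : B) : ‖G a' b' - G a b‖ ≤ L * (‖a' - a‖ + ‖b' - b‖) := by
  have e1 := (h₁ b').norm_sub_le a' a
  have e2 := (h₂ a).norm_sub_le b' b
  have := norm_sub_le_norm_sub_add_norm_sub (G a' b') (G a b') (G a b)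
  nlinarith [norm_nonneg (a' - a), norm_nonneg (b' - b)]

theorem norm_sub_sq_le_of_lipschitzWith (h₁ : ∀ b, LipschitzWith K₁ fun a => G a b)
    (h₂ : ∀ a, LipschitzWith K₂ (G a)) (hK₁ : (K₁ : ℝ) ≤ L) (hK₂ : (K₂ : ℝ) ≤ L)
    (a a' : A) (b b' : B) :
    ‖G a' b' - G a b‖ ^ 2 ≤ 2 * L ^ 2 * (‖a' - a‖ ^ 2 + ‖b' - b‖ ^ 2) := by
  have h := pow_le_pow_left₀ (norm_nonneg _)
    (norm_sub_le_of_lipschitzWith h₁ h₂ hK₁ hK₂ a a' b b') 2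
  nlinarith [mul_nonneg (sq_nonneg L) (sq_nonneg (‖a' - a‖ - ‖b' - b‖))]

end Lipschitz

/-! ### Local iterations of the clients -/

/-- Independent samples `x i k` with laws `D i`. -/
structure IsSample {n : ℕ} {Ξ Ω : Type*} [MeasurableSpace Ξ] [MeasurableSpace Ω]
    (P : Measure Ω) (D : Fin n → Measure Ξ) (x : Fin n → ℕ → Ω → Ξ) : Prop where
  measurable : ∀ i k, Measurable (x i k)
  law : ∀ i k, P.map (x i k) = D i
  indep : iIndepFun (fun p : Fin n × ℕ => x p.1 p.2) P

/-- A measurable family of centred noises with second moment at most `s`. -/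
structure IsNoise {n : ℕ} {α Ξ E : Type*} [MeasurableSpace α] [MeasurableSpace Ξ]
    [NormedAddCommGroup E] [NormedSpace ℝ E] [MeasurableSpace E]
    (D : Fin n → Measure Ξ) (s : ℝ) (h : Fin n → α × Ξ → E) : Prop where
  measurable : ∀ i, Measurable (h i)
  integrable : ∀ i y, Integrable (fun x => h i (y, x)) (D i)
  mean : ∀ i y, ∫ x, h i (y, x) ∂(D i) = 0
  integrable_sq : ∀ i y, Integrable (fun x => ‖h i (y, x)‖ ^ 2) (D i)
  variance : ∀ i y, ∫ x, ‖h i (y, x)‖ ^ 2 ∂(D i) ≤ s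

/-- The `σ`-algebra generated by all samples but the one with index `q`. -/
abbrev othersSigma {n : ℕ} {Ξ Ω : Type*} [MeasurableSpace Ξ] (x : Fin n → ℕ → Ω → Ξ)
    (q : Fin n × ℕ) : MeasurableSpace Ω :=
  ⨆ p ∈ ({q}ᶜ : Set (Fin n × ℕ)), MeasurableSpace.comap (x p.1 p.2) inferInstance

/-- The random local iterates of client `i`. -/
noncomputable def localPath {du dv n : ℕ} {Ξ Ω : Type*} (F : Vec du → Vec dv → Ξ → ℝ) (γu γv : ℝ)
    (x : Fin n → ℕ → Ω → Ξ) (u : Vec du) (v : Fin n → Vec dv) (i : Fin n) (k : ℕ) (ω : Ω) :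
    Vec du × Vec dv :=
  localIter F γu γv (fun k => x i k ω) (u, v i) k

section LocalPath

variable {du dv n : ℕ} {Ξ Ω E : Type*} [MeasurableSpace Ξ] [mΩ : MeasurableSpace Ω]
  {P : Measure Ω} [IsProbabilityMeasure P] {D : Fin n → Measure Ξ} [∀ i, IsProbabilityMeasure (D i)]
  {F : Vec du → Vec dv → Ξ → ℝ} {γu γv : ℝ} {x : Fin n → ℕ → Ω → Ξ}
  {u : Vec du} {v : Fin n → Vec dv}

omit mΩ in
-- Adaptedness: the k-th iterate uses only the samples of index below k. The σ-algebra is left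
-- arbitrary so that the same lemma gives both plain measurability and measurability with respect to
-- `othersSigma`.
theorem measurable_localPath
    (hu : Measurable (fun p : Vec du × Vec dv × Ξ => gradU (fun u v => F u v p.2.2) p.1 p.2.1))
    (hv : Measurable (fun p : Vec du × Vec dv × Ξ => gradV (fun u v => F u v p.2.2) p.1 p.2.1))
    {m' : MeasurableSpace Ω} (i : Fin n) (k : ℕ) (hx : ∀ j < k, Measurable[m'] (x i j)) :
    Measurable[m'] (localPath F γu γv x u v i k) := by
  induction k with
  | zero => exact measurable_const
  | succ k ih =>
    have hk := ih fun j hj => hx j (hj.trans k.lt_succ_self)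
    have hq : Measurable[m'] fun ω => ((localPath F γu γv x u v i k ω).1,
        (localPath F γu γv x u v i k ω).2, x i k ω) :=
      hk.fst.prodMk (hk.snd.prodMk (hx k k.lt_succ_self))
    exact (hk.fst.sub ((hu.comp hq).const_smul γu)).prodMk
      (hk.snd.sub ((hv.comp hq).const_smul γv))

omit [IsProbabilityMeasure P] [∀ i, IsProbabilityMeasure (D i)] in
/-- A sample is independent of every variable that is determined by the other samples. -/
theorem IsSample.indepFun (hx : IsSample P D x) {β : Type*} [MeasurableSpace β]
    (q : Fin n × ℕ) {Y : Ω → β}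
    (hY : Measurable[othersSigma x q] Y) :
    IndepFun Y (x q.1 q.2) P := by
  have h := indep_iSup_of_disjoint (fun p : Fin n × ℕ => (hx.measurable p.1 p.2).comap_le) hx.indep
    (S := {q}ᶜ) (T := {q}) disjoint_compl_left
  rw [iSup_singleton] at h
  exact indep_of_indep_of_le_left h hY.comap_le

omit mΩ in
theorem measurable_sample_of_ne {p q : Fin n × ℕ} (hpq : p ≠ q) :
    Measurable[othersSigma x q] (x p.1 p.2) := by
  refine Measurable.mono (comap_measurable _) ?_ le_rfl
  exact le_iSup₂_of_le p hpq le_rfl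

variable [NormedAddCommGroup E] [InnerProductSpace ℝ E] [CompleteSpace E] [MeasurableSpace E]
  [BorelSpace E] [SecondCountableTopology E] {s : ℝ} {h : Fin n → (Vec du × Vec dv) × Ξ → E}

omit [IsProbabilityMeasure P] [∀ i, IsProbabilityMeasure (D i)] in
theorem indepFun_localPath
    (hu : Measurable (fun p : Vec du × Vec dv × Ξ => gradU (fun u v => F u v p.2.2) p.1 p.2.1))
    (hv : Measurable (fun p : Vec du × Vec dv × Ξ => gradV (fun u v => F u v p.2.2) p.1 p.2.1))
    (hx : IsSample P D x) (q : Fin n × ℕ) :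
    IndepFun (localPath F γu γv x u v q.1 q.2) (x q.1 q.2) P := by
  refine hx.indepFun q (measurable_localPath hu hv q.1 q.2 fun j hj => ?_)
  exact measurable_sample_of_ne (p := (q.1, j)) fun h => hj.ne (congrArg Prod.snd h)

omit [CompleteSpace E] [∀ i, IsProbabilityMeasure (D i)] in
theorem IsNoise.memLp (hh : IsNoise D s h)
    (hu : Measurable (fun p : Vec du × Vec dv × Ξ => gradU (fun u v => F u v p.2.2) p.1 p.2.1))
    (hv : Measurable (fun p : Vec du × Vec dv × Ξ => gradV (fun u v => F u v p.2.2) p.1 p.2.1))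
    (hx : IsSample P D x) (i : Fin n) (k : ℕ) :
    MemLp (fun ω => h i (localPath F γu γv x u v i k ω, x i k ω)) 2 P ∧
      ∫ ω, ‖h i (localPath F γu γv x u v i k ω, x i k ω)‖ ^ 2 ∂P ≤ s :=
  memLp_noise (hh.measurable i) (measurable_localPath hu hv i k fun j _ => hx.measurable i j)
    (hx.measurable i k) (hx.law i k) (indepFun_localPath hu hv hx (i, k)) (hh.integrable_sq i)
    (hh.variance i)

theorem IsNoise.integral_inner_const (hh : IsNoise D s h)
    (hu : Measurable (fun p : Vec du × Vec dv × Ξ => gradU (fun u v => F u v p.2.2) p.1 p.2.1))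
    (hv : Measurable (fun p : Vec du × Vec dv × Ξ => gradV (fun u v => F u v p.2.2) p.1 p.2.1))
    (hx : IsSample P D x) (i : Fin n) (k : ℕ) (c : E) :
    ∫ ω, inner ℝ c (h i (localPath F γu γv x u v i k ω, x i k ω)) ∂P = 0 :=
  integral_inner_noise (hh.measurable i)
    (measurable_localPath hu hv i k fun j _ => hx.measurable i j)
    (hx.measurable i k) (hx.law i k) (indepFun_localPath hu hv hx (i, k)) (hh.integrable i)
    (hh.mean i) (w := fun _ => c) measurable_const (memLp_const c) (hh.memLp hu hv hx i k).1

/-- Of two different noises, one can be chosen (that of another client, or the later one of the same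
client) whose sample enters neither the other noise nor its own base point. Given all other samples,
this noise is centred and the other one is constant. -/
theorem IsNoise.integral_inner_eq_zero (hh : IsNoise D s h)
    (hu : Measurable (fun p : Vec du × Vec dv × Ξ => gradU (fun u v => F u v p.2.2) p.1 p.2.1))
    (hv : Measurable (fun p : Vec du × Vec dv × Ξ => gradV (fun u v => F u v p.2.2) p.1 p.2.1))
    (hx : IsSample P D x) {p q : Fin n × ℕ} (hpq : p ≠ q) :
    ∫ ω, inner ℝ (h p.1 (localPath F γu γv x u v p.1 p.2 ω, x p.1 p.2 ω))
      (h q.1 (localPath F γu γv x u v q.1 q.2 ω, x q.1 q.2 ω)) ∂P = 0 := by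
  -- In the remaining case the client is the same and q precedes p, so exchanging the two roles
  -- suffices.
  wlog hlt : p.1 ≠ q.1 ∨ p.2 < q.2 generalizing p q
  · simp_rw [real_inner_comm (h q.1 _)]
    refine this hpq.symm (Or.inr ?_)
    push Not at hlt
    refine lt_of_le_of_ne hlt.2 fun h => hpq (Prod.ext hlt.1 h.symm)
  have hne : ∀ j ≤ p.2, (p.1, j) ≠ q := by
    rintro j hj rfl
    rcases hlt with h | h
    · exact h rfl
    · exact absurd hj (not_le.2 h)
  have hX : Measurable[othersSigma x q] (localPath F γu γv x u v q.1 q.2) :=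
    measurable_localPath hu hv q.1 q.2 fun j hj =>
      measurable_sample_of_ne (p := (q.1, j)) fun h => hj.ne (congrArg Prod.snd h)
  have hW : Measurable[othersSigma x q] fun ω => h p.1 (localPath F γu γv x u v p.1 p.2 ω, x p.1 p.2 ω) :=
    (hh.measurable p.1).comp
      ((measurable_localPath hu hv p.1 p.2 fun j hj =>
        measurable_sample_of_ne (p := (p.1, j)) (hne j hj.le)).prodMk
          (measurable_sample_of_ne (hne p.2 le_rfl)))
  have hm' : othersSigma x q ≤ mΩ := iSup₂_le fun p _ => (hx.measurable p.1 p.2).comap_le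
  -- The frozen variable is the pair (base point of the noise at q, whole noise at p), and `w`
  -- extracts the latter.
  exact integral_inner_noise (α := (Vec du × Vec dv) × E) (w := Prod.snd)
    (h := fun z => h q.1 (z.1.1, z.2))
    (Y := fun ω => (localPath F γu γv x u v q.1 q.2 ω,
      h p.1 (localPath F γu γv x u v p.1 p.2 ω, x p.1 p.2 ω)))
    ((hh.measurable q.1).comp (measurable_fst.fst.prodMk measurable_snd))
    ((hX.prodMk hW).mono hm' le_rfl) (hx.measurable q.1 q.2) (hx.law q.1 q.2)
    (hx.indepFun q (hX.prodMk hW)) (fun y => hh.integrable q.1 y.1) (fun y => hh.mean q.1 y.1)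
    measurable_snd (hh.memLp hu hv hx p.1 p.2).1 (hh.memLp hu hv hx q.1 q.2).1

omit [CompleteSpace E] [MeasurableSpace E] [BorelSpace E] [SecondCountableTopology E]
  [IsProbabilityMeasure P] in
-- Pythagoras in L²: the mixed terms vanish, so the bound is linear in the number of summands.
theorem integral_norm_sq_sum_le_of_orthogonal {ι : Type*} {e : ι → Ω → E}
    (he : ∀ p, MemLp (e p) 2 P) (hs : ∀ p, ∫ ω, ‖e p ω‖ ^ 2 ∂P ≤ s)
    (horth : ∀ p q, p ≠ q → ∫ ω, inner ℝ (e p ω) (e q ω) ∂P = 0) (t : Finset ι) :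
    ∫ ω, ‖∑ p ∈ t, e p ω‖ ^ 2 ∂P ≤ t.card * s := by
  classical
  have hint : ∀ p q, Integrable (fun ω => (inner ℝ (e p ω) (e q ω) : ℝ)) P := fun p q =>
    ((he p).norm.integrable_mul (he q).norm).mono'
      ((he p).aestronglyMeasurable.inner (he q).aestronglyMeasurable)
      (Filter.Eventually.of_forall fun ω => norm_inner_le_norm _ _)
  have h1 : ∀ ω, ‖∑ p ∈ t, e p ω‖ ^ 2 = ∑ p ∈ t, ∑ q ∈ t, (inner ℝ (e p ω) (e q ω) : ℝ) := by
    intro ω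
    rw [← real_inner_self_eq_norm_sq, sum_inner]
    simp_rw [inner_sum]
  simp_rw [h1]
  rw [integral_finsetSum _ fun p _ => integrable_finsetSum _ fun q _ => hint p q]
  calc _ ≤ ∑ p ∈ t, s := by
        refine Finset.sum_le_sum fun p hp => ?_
        rw [integral_finsetSum _ fun q _ => hint p q, Finset.sum_eq_single p
          (fun q _ hq => horth p q hq.symm) (fun h => absurd hp h)]
        simpa only [real_inner_self_eq_norm_sq] using hs p
    _ = _ := by simp

theorem IsNoise.integral_norm_sq_sum_le (hh : IsNoise D s h)
    (hu : Measurable (fun p : Vec du × Vec dv × Ξ => gradU (fun u v => F u v p.2.2) p.1 p.2.1))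
    (hv : Measurable (fun p : Vec du × Vec dv × Ξ => gradV (fun u v => F u v p.2.2) p.1 p.2.1))
    (hx : IsSample P D x) (A : Finset (Fin n)) (k : ℕ) :
    ∫ ω, ‖∑ i ∈ A, ∑ j ∈ Finset.range k,
      h i (localPath F γu γv x u v i j ω, x i j ω)‖ ^ 2 ∂P ≤ A.card * k * s := by
  have := integral_norm_sq_sum_le_of_orthogonal (P := P) (s := s)
    (e := fun (p : Fin n × ℕ) ω => h p.1 (localPath F γu γv x u v p.1 p.2 ω, x p.1 p.2 ω))
    (fun p => (hh.memLp hu hv hx p.1 p.2).1) (fun p => (hh.memLp hu hv hx p.1 p.2).2)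
    (fun p q hpq => hh.integral_inner_eq_zero hu hv hx hpq) (A ×ˢ Finset.range k)
  simpa [Finset.sum_product] using this

end LocalPath

/-! ### Drift of the local iterates -/

theorem norm_sum_sq_le_card_mul {ι E : Type*} [SeminormedAddCommGroup E] (s : Finset ι)
    (a : ι → E) : ‖∑ i ∈ s, a i‖ ^ 2 ≤ s.card * ∑ i ∈ s, ‖a i‖ ^ 2 :=
  (pow_le_pow_left₀ (norm_nonneg _) (norm_sum_le s a) 2).trans sq_sum_le_card_mul_sum_sq

theorem norm_add_sq_le_two_mul {E : Type*} [SeminormedAddCommGroup E] (a b : E) :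
    ‖a + b‖ ^ 2 ≤ 2 * ‖a‖ ^ 2 + 2 * ‖b‖ ^ 2 := by
  have := pow_le_pow_left₀ (norm_nonneg _) (norm_add_le a b) 2
  nlinarith [sq_nonneg (‖a‖ - ‖b‖)]

/-- Two applications of ‖a + b‖² ≤ 2‖a‖² + 2‖b‖² give the constants 2, 4, 4. The noise carries K by
orthogonality; the drift and the gradient are summed by Cauchy–Schwarz or directly and carry a
factor K more. -/
theorem integral_norm_sq_step_le {Ω E : Type*} [MeasurableSpace Ω] {P : Measure Ω}
    [IsProbabilityMeasure P] [NormedAddCommGroup E] [NormedSpace ℝ E] {e a : ℕ → Ω → E}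
    (he : ∀ j, MemLp (e j) 2 P) (ha : ∀ j, MemLp (a j) 2 P) (g : E) (γ : ℝ) {s : ℝ} (hs : 0 ≤ s)
    {k K : ℕ} (hk : k ≤ K) (hN : ∫ ω, ‖∑ j ∈ Finset.range k, e j ω‖ ^ 2 ∂P ≤ k * s) :
    ∫ ω, ‖γ • (∑ j ∈ Finset.range k, e j ω + ∑ j ∈ Finset.range k, a j ω + (k : ℝ) • g)‖ ^ 2 ∂P
      ≤ γ ^ 2 * (2 * K * s + 4 * K * ∑ j ∈ Finset.range K, ∫ ω, ‖a j ω‖ ^ 2 ∂P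
          + 4 * K ^ 2 * ‖g‖ ^ 2) := by
  have hk' : (k : ℝ) ≤ K := by exact_mod_cast hk
  have hN2 : Integrable (fun ω => ‖∑ j ∈ Finset.range k, e j ω‖ ^ 2) P :=
    (memLp_finsetSum _ fun j _ => he j).integrable_norm_pow two_ne_zero
  have ha2 : ∀ j, Integrable (fun ω => ‖a j ω‖ ^ 2) P :=
    fun j => (ha j).integrable_norm_pow two_ne_zero
  have hA2 : Integrable (fun ω => ∑ j ∈ Finset.range K, ‖a j ω‖ ^ 2) P :=
    integrable_finsetSum _ fun j _ => ha2 j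
  have hpt : ∀ ω,
      ‖γ • (∑ j ∈ Finset.range k, e j ω + ∑ j ∈ Finset.range k, a j ω + (k : ℝ) • g)‖ ^ 2
      ≤ γ ^ 2 * (2 * ‖∑ j ∈ Finset.range k, e j ω‖ ^ 2
        + 4 * K * ∑ j ∈ Finset.range K, ‖a j ω‖ ^ 2 + 4 * K ^ 2 * ‖g‖ ^ 2) := by
    intro ω
    rw [norm_smul, mul_pow, Real.norm_eq_abs, sq_abs, add_assoc]
    refine mul_le_mul_of_nonneg_left ?_ (sq_nonneg γ)
    have h1 := norm_add_sq_le_two_mul (∑ j ∈ Finset.range k, e j ω)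
      (∑ j ∈ Finset.range k, a j ω + (k : ℝ) • g)
    have h2 := norm_add_sq_le_two_mul (∑ j ∈ Finset.range k, a j ω) ((k : ℝ) • g)
    have h3 : ‖∑ j ∈ Finset.range k, a j ω‖ ^ 2 ≤ K * ∑ j ∈ Finset.range K, ‖a j ω‖ ^ 2 := by
      refine (norm_sum_sq_le_card_mul _ _).trans ?_
      rw [Finset.card_range]
      refine mul_le_mul hk' (Finset.sum_le_sum_of_subset_of_nonneg
        (Finset.range_mono hk) fun _ _ _ => by positivity) (by positivity) (by positivity)
    have h4 : ‖(k : ℝ) • g‖ ^ 2 ≤ K ^ 2 * ‖g‖ ^ 2 := by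
      rw [norm_smul, mul_pow, Real.norm_natCast]
      gcongr
    linarith
  refine (integral_mono_of_nonneg (Filter.Eventually.of_forall fun ω => by positivity) ?_
    (Filter.Eventually.of_forall hpt)).trans ?_
  · exact (((hN2.const_mul 2).add (hA2.const_mul _)).add (integrable_const _)).const_mul _
  · have hi : Integrable (fun ω => 2 * ‖∑ j ∈ Finset.range k, e j ω‖ ^ 2
        + 4 * K * ∑ j ∈ Finset.range K, ‖a j ω‖ ^ 2) P :=
      (hN2.const_mul 2).add (hA2.const_mul _)
    rw [integral_const_mul, integral_add hi (integrable_const _),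
      integral_add (hN2.const_mul 2) (hA2.const_mul _), integral_const_mul,
      integral_const_mul, integral_finsetSum _ fun j _ => ha2 j]
    refine mul_le_mul_of_nonneg_left ?_ (sq_nonneg γ)
    have : (k : ℝ) * s ≤ K * s := mul_le_mul_of_nonneg_right hk' hs
    simp only [integral_const, probReal_univ, one_smul]
    linarith

/-- The standing assumptions for one round of the algorithm. -/
structure RoundAssumptions {du dv n : ℕ} {Ξ Ω : Type*} [MeasurableSpace Ξ] [MeasurableSpace Ω]
    (F : Vec du → Vec dv → Ξ → ℝ) (D : Fin n → Measure Ξ) (Lu Lv Luv Lvu : ℝ≥0) (L σu σv : ℝ)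
    (P : Measure Ω) (x : Fin n → ℕ → Ω → Ξ) : Prop where
  smooth : Smoothness F D Lu Lv Luv Lvu
  le_u : (Lu : ℝ) ≤ L
  le_v : (Lv : ℝ) ≤ L
  le_uv : (Luv : ℝ) ≤ L
  le_vu : (Lvu : ℝ) ≤ L
  stochastic : StochasticGradient F D σu σv
  sample : IsSample P D x

/-- Noise of the stochastic gradient in `u`. -/
noncomputable def noiseU {du dv n : ℕ} {Ξ : Type*} [MeasurableSpace Ξ]
    (F : Vec du → Vec dv → Ξ → ℝ) (D : Fin n → Measure Ξ) (i : Fin n)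
    (z : (Vec du × Vec dv) × Ξ) : Vec du :=
  gradU (fun u v => F u v z.2) z.1.1 z.1.2 - gradU (localObj F (D i)) z.1.1 z.1.2

/-- Noise of the stochastic gradient in `v`. -/
noncomputable def noiseV {du dv n : ℕ} {Ξ : Type*} [MeasurableSpace Ξ]
    (F : Vec du → Vec dv → Ξ → ℝ) (D : Fin n → Measure Ξ) (i : Fin n)
    (z : (Vec du × Vec dv) × Ξ) : Vec dv :=
  gradV (fun u v => F u v z.2) z.1.1 z.1.2 - gradV (localObj F (D i)) z.1.1 z.1.2

section Client

variable {du dv n : ℕ} {Ξ Ω : Type*} [MeasurableSpace Ξ] [MeasurableSpace Ω]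
  {P : Measure Ω} [IsProbabilityMeasure P] {D : Fin n → Measure Ξ} [∀ i, IsProbabilityMeasure (D i)]
  {F : Vec du → Vec dv → Ξ → ℝ} {Lu Lv Luv Lvu : ℝ≥0} {L σu σv : ℝ} {x : Fin n → ℕ → Ω → Ξ}

omit [∀ i, IsProbabilityMeasure (D i)] in
theorem Smoothness.continuous_gradU (h : Smoothness F D Lu Lv Luv Lvu) (i : Fin n) :
    Continuous fun p : Vec du × Vec dv => gradU (localObj F (D i)) p.1 p.2 :=
  (LipschitzWith.uncurry (h.lipschitz_uu i) (h.lipschitz_uv i)).continuous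

omit [∀ i, IsProbabilityMeasure (D i)] in
theorem Smoothness.continuous_gradV (h : Smoothness F D Lu Lv Luv Lvu) (i : Fin n) :
    Continuous fun p : Vec du × Vec dv => gradV (localObj F (D i)) p.1 p.2 :=
  (LipschitzWith.uncurry (h.lipschitz_vu i) (h.lipschitz_vv i)).continuous

theorem isNoise_noiseU (hs : Smoothness F D Lu Lv Luv Lvu) (hg : StochasticGradient F D σu σv) :
    IsNoise D (σu ^ 2) (noiseU F D) where
  measurable i := (hg.measurable_u.comp
    (measurable_fst.fst.prodMk (measurable_fst.snd.prodMk measurable_snd))).sub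
      ((hs.continuous_gradU i).measurable.comp measurable_fst)
  integrable i y := (hg.integrable_u i y.1 y.2).sub
    (integrable_const (gradU (localObj F (D i)) y.1 y.2))
  mean i y := by
    have h := integral_sub (hg.integrable_u i y.1 y.2)
      (integrable_const (μ := D i) (gradU (localObj F (D i)) y.1 y.2))
    rw [hg.unbiased_u, integral_const, probReal_univ, one_smul, sub_self] at h
    exact h
  integrable_sq i y := hg.integrable_sq_u i y.1 y.2
  variance i y := hg.variance_u i y.1 y.2

theorem isNoise_noiseV (hs : Smoothness F D Lu Lv Luv Lvu) (hg : StochasticGradient F D σu σv) :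
    IsNoise D (σv ^ 2) (noiseV F D) where
  measurable i := (hg.measurable_v.comp
    (measurable_fst.fst.prodMk (measurable_fst.snd.prodMk measurable_snd))).sub
      ((hs.continuous_gradV i).measurable.comp measurable_fst)
  integrable i y := (hg.integrable_v i y.1 y.2).sub
    (integrable_const (gradV (localObj F (D i)) y.1 y.2))
  mean i y := by
    have h := integral_sub (hg.integrable_v i y.1 y.2)
      (integrable_const (μ := D i) (gradV (localObj F (D i)) y.1 y.2))
    rw [hg.unbiased_v, integral_const, probReal_univ, one_smul, sub_self] at h
    exact h
  integrable_sq i y := hg.integrable_sq_v i y.1 y.2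
  variance i y := hg.variance_v i y.1 y.2

variable (γu γv : ℝ) (u : Vec du) (v : Fin n → Vec dv)

/-- Drift of the gradient in `u` at the `k`-th local step. -/
noncomputable def gradDriftU (F : Vec du → Vec dv → Ξ → ℝ) (D : Fin n → Measure Ξ)
    (x : Fin n → ℕ → Ω → Ξ) (i : Fin n) (k : ℕ) (ω : Ω) : Vec du :=
  gradU (localObj F (D i)) (localPath F γu γv x u v i k ω).1 (localPath F γu γv x u v i k ω).2
    - gradU (localObj F (D i)) u (v i)

/-- Drift of the gradient in `v` at the `k`-th local step. -/
noncomputable def gradDriftV (F : Vec du → Vec dv → Ξ → ℝ) (D : Fin n → Measure Ξ)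
    (x : Fin n → ℕ → Ω → Ξ) (i : Fin n) (k : ℕ) (ω : Ω) : Vec dv :=
  gradV (localObj F (D i)) (localPath F γu γv x u v i k ω).1 (localPath F γu γv x u v i k ω).2
    - gradV (localObj F (D i)) u (v i)

/-- Noise in `u` at the `k`-th local step. -/
noncomputable def stepNoiseU (F : Vec du → Vec dv → Ξ → ℝ) (D : Fin n → Measure Ξ)
    (x : Fin n → ℕ → Ω → Ξ) (i : Fin n) (k : ℕ) (ω : Ω) : Vec du :=
  noiseU F D i (localPath F γu γv x u v i k ω, x i k ω)

/-- Noise in `v` at the `k`-th local step. -/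
noncomputable def stepNoiseV (F : Vec du → Vec dv → Ξ → ℝ) (D : Fin n → Measure Ξ)
    (x : Fin n → ℕ → Ω → Ξ) (i : Fin n) (k : ℕ) (ω : Ω) : Vec dv :=
  noiseV F D i (localPath F γu γv x u v i k ω, x i k ω)

/-- Total expected squared deviation of the local iterates of client `i`. -/
noncomputable def drift (F : Vec du → Vec dv → Ξ → ℝ) (P : Measure Ω)
    (x : Fin n → ℕ → Ω → Ξ) (K : ℕ) (i : Fin n) : ℝ :=
  ∑ k ∈ Finset.range K, ∫ ω, (‖(localPath F γu γv x u v i k ω).1 - u‖ ^ 2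
    + ‖(localPath F γu γv x u v i k ω).2 - v i‖ ^ 2) ∂P

omit [MeasurableSpace Ω] [∀ i, IsProbabilityMeasure (D i)] in
variable (F D x) in
-- This decomposition drives all estimates: the first sum is orthogonal noise, the second is
-- controlled by the Lipschitz bounds, and the last term is deterministic for a fixed initial state.
theorem localPath_fst (i : Fin n) (k : ℕ) (ω : Ω) :
    (localPath F γu γv x u v i k ω).1 = u - γu •
      (∑ j ∈ Finset.range k, stepNoiseU γu γv u v F D x i j ω
        + ∑ j ∈ Finset.range k, gradDriftU γu γv u v F D x i j ω
        + (k : ℝ) • gradU (localObj F (D i)) u (v i)) := by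
  induction k with
  | zero => simp [localPath, localIter]
  | succ k ih =>
    have : (localPath F γu γv x u v i (k + 1) ω).1 = (localPath F γu γv x u v i k ω).1
        - γu • (stepNoiseU γu γv u v F D x i k ω + gradDriftU γu γv u v F D x i k ω
          + gradU (localObj F (D i)) u (v i)) := by
      simp [stepNoiseU, gradDriftU, noiseU, localPath, localIter]
    rw [this, ih, Finset.sum_range_succ, Finset.sum_range_succ]
    push_cast
    module

omit [MeasurableSpace Ω] [∀ i, IsProbabilityMeasure (D i)] in
variable (F D x) in
theorem localPath_snd (i : Fin n) (k : ℕ) (ω : Ω) :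
    (localPath F γu γv x u v i k ω).2 = v i - γv •
      (∑ j ∈ Finset.range k, stepNoiseV γu γv u v F D x i j ω
        + ∑ j ∈ Finset.range k, gradDriftV γu γv u v F D x i j ω
        + (k : ℝ) • gradV (localObj F (D i)) u (v i)) := by
  induction k with
  | zero => simp [localPath, localIter]
  | succ k ih =>
    have : (localPath F γu γv x u v i (k + 1) ω).2 = (localPath F γu γv x u v i k ω).2
        - γv • (stepNoiseV γu γv u v F D x i k ω + gradDriftV γu γv u v F D x i k ω
          + gradV (localObj F (D i)) u (v i)) := by
      simp [stepNoiseV, gradDriftV, noiseV, localPath, localIter]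
    rw [this, ih, Finset.sum_range_succ, Finset.sum_range_succ]
    push_cast
    module

variable (hR : RoundAssumptions F D Lu Lv Luv Lvu L σu σv P x)
include hR

theorem RoundAssumptions.memLp_stepNoiseU (i : Fin n) (k : ℕ) :
    MemLp (stepNoiseU γu γv u v F D x i k) 2 P :=
  ((isNoise_noiseU hR.smooth hR.stochastic).memLp hR.stochastic.measurable_u
    hR.stochastic.measurable_v hR.sample i k).1

theorem RoundAssumptions.memLp_stepNoiseV (i : Fin n) (k : ℕ) :
    MemLp (stepNoiseV γu γv u v F D x i k) 2 P :=
  ((isNoise_noiseV hR.smooth hR.stochastic).memLp hR.stochastic.measurable_u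
    hR.stochastic.measurable_v hR.sample i k).1

omit [IsProbabilityMeasure P] [∀ i, IsProbabilityMeasure (D i)] in
theorem RoundAssumptions.measurable_localPath (i : Fin n) (k : ℕ) :
    Measurable (localPath F γu γv x u v i k) :=
  FedAvgP.measurable_localPath hR.stochastic.measurable_u hR.stochastic.measurable_v i k
    fun j _ => hR.sample.measurable i j

omit [MeasurableSpace Ω] [∀ i, IsProbabilityMeasure (D i)] [IsProbabilityMeasure P] hR in
theorem norm_gradDriftU_le (hs : Smoothness F D Lu Lv Luv Lvu) (h1 : (Lu : ℝ) ≤ L)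
    (h2 : (Luv : ℝ) ≤ L) (i : Fin n) (k : ℕ) (ω : Ω) :
    ‖gradDriftU γu γv u v F D x i k ω‖ ≤ L * (‖(localPath F γu γv x u v i k ω).1 - u‖
      + ‖(localPath F γu γv x u v i k ω).2 - v i‖) :=
  norm_sub_le_of_lipschitzWith (hs.lipschitz_uu i) (hs.lipschitz_uv i) h1 h2 _ _ _ _

omit [MeasurableSpace Ω] [∀ i, IsProbabilityMeasure (D i)] [IsProbabilityMeasure P] hR in
theorem norm_gradDriftV_le (hs : Smoothness F D Lu Lv Luv Lvu) (h1 : (Lv : ℝ) ≤ L)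
    (h2 : (Lvu : ℝ) ≤ L) (i : Fin n) (k : ℕ) (ω : Ω) :
    ‖gradDriftV γu γv u v F D x i k ω‖ ≤ L * (‖(localPath F γu γv x u v i k ω).1 - u‖
      + ‖(localPath F γu γv x u v i k ω).2 - v i‖) :=
  norm_sub_le_of_lipschitzWith (hs.lipschitz_vu i) (hs.lipschitz_vv i) h2 h1 _ _ _ _

omit [IsProbabilityMeasure P] [∀ i, IsProbabilityMeasure (D i)] in
theorem RoundAssumptions.memLp_gradDrift_of_memLp (i : Fin n) (k : ℕ)
    (h1 : MemLp (fun ω => (localPath F γu γv x u v i k ω).1 - u) 2 P)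
    (h2 : MemLp (fun ω => (localPath F γu γv x u v i k ω).2 - v i) 2 P) :
    MemLp (gradDriftU γu γv u v F D x i k) 2 P ∧ MemLp (gradDriftV γu γv u v F D x i k) 2 P := by
  have hm := hR.measurable_localPath γu γv u v i k
  have hb := (h1.norm.add h2.norm).const_mul L
  refine ⟨hb.of_le (((hR.smooth.continuous_gradU i).measurable.comp hm).sub_const
      _).aestronglyMeasurable (Filter.Eventually.of_forall fun ω => ?_),
    hb.of_le (((hR.smooth.continuous_gradV i).measurable.comp hm).sub_const
      _).aestronglyMeasurable (Filter.Eventually.of_forall fun ω => ?_)⟩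
  · exact (norm_gradDriftU_le γu γv u v hR.smooth hR.le_u hR.le_uv i k ω).trans (le_abs_self _)
  · exact (norm_gradDriftV_le γu γv u v hR.smooth hR.le_v hR.le_vu i k ω).trans (le_abs_self _)

/-- Strong induction: the k-th deviation is a combination of noises and of gradient drifts at j < k,
and each such drift is dominated by the deviation at j. -/
theorem RoundAssumptions.memLp_localPath (i : Fin n) (k : ℕ) :
    MemLp (fun ω => (localPath F γu γv x u v i k ω).1 - u) 2 P ∧
      MemLp (fun ω => (localPath F γu γv x u v i k ω).2 - v i) 2 P := by
  induction k using Nat.strong_induction_on with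
  | _ k ih =>
    have hG := fun j (hj : j < k) =>
      hR.memLp_gradDrift_of_memLp γu γv u v i j (ih j hj).1 (ih j hj).2
    simp only [localPath_fst D F, localPath_snd D F, sub_sub_cancel_left]
    constructor
    · exact ((((memLp_finsetSum _ fun j _ => hR.memLp_stepNoiseU γu γv u v i j).add
        (memLp_finsetSum _ fun j hj => (hG j (Finset.mem_range.1 hj)).1)).add
          (memLp_const _)).const_smul γu).neg
    · exact ((((memLp_finsetSum _ fun j _ => hR.memLp_stepNoiseV γu γv u v i j).add
        (memLp_finsetSum _ fun j hj => (hG j (Finset.mem_range.1 hj)).2)).add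
          (memLp_const _)).const_smul γv).neg

theorem RoundAssumptions.memLp_gradDriftU (i : Fin n) (k : ℕ) :
    MemLp (gradDriftU γu γv u v F D x i k) 2 P :=
  (hR.memLp_gradDrift_of_memLp γu γv u v i k (hR.memLp_localPath γu γv u v i k).1
    (hR.memLp_localPath γu γv u v i k).2).1

theorem RoundAssumptions.memLp_gradDriftV (i : Fin n) (k : ℕ) :
    MemLp (gradDriftV γu γv u v F D x i k) 2 P :=
  (hR.memLp_gradDrift_of_memLp γu γv u v i k (hR.memLp_localPath γu γv u v i k).1
    (hR.memLp_localPath γu γv u v i k).2).2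

theorem RoundAssumptions.sum_integral_norm_sq_gradDriftU_le (i : Fin n) (K : ℕ) :
    ∑ k ∈ Finset.range K, ∫ ω, ‖gradDriftU γu γv u v F D x i k ω‖ ^ 2 ∂P
      ≤ 2 * L ^ 2 * drift γu γv u v F P x K i := by
  rw [drift, Finset.mul_sum]
  refine Finset.sum_le_sum fun k _ => ?_
  rw [← integral_const_mul]
  refine integral_mono ((hR.memLp_gradDriftU γu γv u v i k).integrable_norm_pow two_ne_zero) ?_
    fun ω => ?_
  · exact (((hR.memLp_localPath γu γv u v i k).1.integrable_norm_pow two_ne_zero).add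
      ((hR.memLp_localPath γu γv u v i k).2.integrable_norm_pow two_ne_zero)).const_mul _
  · exact norm_sub_sq_le_of_lipschitzWith (hR.smooth.lipschitz_uu i) (hR.smooth.lipschitz_uv i)
      hR.le_u hR.le_uv _ _ _ _

theorem RoundAssumptions.sum_integral_norm_sq_gradDriftV_le (i : Fin n) (K : ℕ) :
    ∑ k ∈ Finset.range K, ∫ ω, ‖gradDriftV γu γv u v F D x i k ω‖ ^ 2 ∂P
      ≤ 2 * L ^ 2 * drift γu γv u v F P x K i := by
  rw [drift, Finset.mul_sum]
  refine Finset.sum_le_sum fun k _ => ?_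
  rw [← integral_const_mul]
  refine integral_mono ((hR.memLp_gradDriftV γu γv u v i k).integrable_norm_pow two_ne_zero) ?_
    fun ω => ?_
  · exact (((hR.memLp_localPath γu γv u v i k).1.integrable_norm_pow two_ne_zero).add
      ((hR.memLp_localPath γu γv u v i k).2.integrable_norm_pow two_ne_zero)).const_mul _
  · exact norm_sub_sq_le_of_lipschitzWith (hR.smooth.lipschitz_vu i) (hR.smooth.lipschitz_vv i)
      hR.le_vu hR.le_v _ _ _ _

theorem RoundAssumptions.integral_norm_sq_sum_stepNoiseU_le (A : Finset (Fin n)) (k : ℕ) :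
    ∫ ω, ‖∑ i ∈ A, ∑ j ∈ Finset.range k, stepNoiseU γu γv u v F D x i j ω‖ ^ 2 ∂P
      ≤ A.card * k * σu ^ 2 :=
  (isNoise_noiseU hR.smooth hR.stochastic).integral_norm_sq_sum_le hR.stochastic.measurable_u
    hR.stochastic.measurable_v hR.sample A k

theorem RoundAssumptions.integral_norm_sq_sum_stepNoiseV_le (A : Finset (Fin n)) (k : ℕ) :
    ∫ ω, ‖∑ i ∈ A, ∑ j ∈ Finset.range k, stepNoiseV γu γv u v F D x i j ω‖ ^ 2 ∂P
      ≤ A.card * k * σv ^ 2 :=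
  (isNoise_noiseV hR.smooth hR.stochastic).integral_norm_sq_sum_le hR.stochastic.measurable_u
    hR.stochastic.measurable_v hR.sample A k

/-- The drift stands on both sides because the deviation of the iterates feeds on the deviation of
the gradients; the loop is closed in `round_average_numeric`. The outer K counts the local steps,
and 8KL² = 4K · 2L² combines Cauchy–Schwarz with the Lipschitz bound. -/
theorem RoundAssumptions.drift_le (i : Fin n) (K : ℕ) :
    drift γu γv u v F P x K i ≤ K * (2 * K * (γu ^ 2 * σu ^ 2 + γv ^ 2 * σv ^ 2)
      + 4 * K ^ 2 * (γu ^ 2 * ‖gradU (localObj F (D i)) u (v i)‖ ^ 2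
        + γv ^ 2 * ‖gradV (localObj F (D i)) u (v i)‖ ^ 2)
      + 8 * K * L ^ 2 * (γu ^ 2 + γv ^ 2) * drift γu γv u v F P x K i) := by
  set d := drift γu γv u v F P x K i with hd
  conv_lhs => rw [hd, drift]
  refine (Finset.sum_le_card_nsmul _ _ _ fun k hk => ?_).trans_eq
    (by rw [Finset.card_range, nsmul_eq_mul])
  have hk' : k ≤ K := (Finset.mem_range.1 hk).le
  rw [integral_add ((hR.memLp_localPath γu γv u v i k).1.integrable_norm_pow two_ne_zero)
    ((hR.memLp_localPath γu γv u v i k).2.integrable_norm_pow two_ne_zero)]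
  simp only [localPath_fst D F, localPath_snd D F, sub_sub_cancel_left, norm_neg]
  have h1 := integral_norm_sq_step_le (hR.memLp_stepNoiseU γu γv u v i)
    (hR.memLp_gradDriftU γu γv u v i) (gradU (localObj F (D i)) u (v i)) γu (sq_nonneg σu) hk'
    (by simpa using hR.integral_norm_sq_sum_stepNoiseU_le γu γv u v {i} k)
  have h2 := integral_norm_sq_step_le (hR.memLp_stepNoiseV γu γv u v i)
    (hR.memLp_gradDriftV γu γv u v i) (gradV (localObj F (D i)) u (v i)) γv (sq_nonneg σv) hk'
    (by simpa using hR.integral_norm_sq_sum_stepNoiseV_le γu γv u v {i} k)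
  have h3 := mul_le_mul_of_nonneg_left (hR.sum_integral_norm_sq_gradDriftU_le γu γv u v i K)
    (by positivity : 0 ≤ γu ^ 2 * (4 * K))
  have h4 := mul_le_mul_of_nonneg_left (hR.sum_integral_norm_sq_gradDriftV_le γu γv u v i K)
    (by positivity : 0 ≤ γv ^ 2 * (4 * K))
  linarith

end Client

/-! ### One step of the objective -/

section Objective

variable {du dv n : ℕ} {Ξ : Type*} [MeasurableSpace Ξ] {D : Fin n → Measure Ξ}
  {F : Vec du → Vec dv → Ξ → ℝ} {Lu Lv Luv Lvu : ℝ≥0} {L : ℝ}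

theorem Smoothness.globalGradU_eq (hs : Smoothness F D Lu Lv Luv Lvu) (u : Vec du)
    (v : Fin n → Vec dv) :
    globalGradU F D u v = (1 / (n : ℝ)) • ∑ i, gradU (localObj F (D i)) u (v i) := by
  refine HasGradientAt.gradient ?_
  rw [hasGradientAt_iff_hasFDerivAt, map_smul, map_sum]
  refine (HasFDerivAt.fun_sum fun i _ => ?_).const_mul (1 / (n : ℝ))
  exact ((hs.differentiable_u i (v i)) u).hasGradientAt.hasFDerivAt

/-- The path goes from (u, v) to (u, v') and then to (u', v'). The second leg sees ∇_u at v' instead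
of v, an error of at most L‖v' - v‖‖u' - u‖, which is split evenly and raises both quadratic
constants from L/2 to L. -/
theorem Smoothness.localObj_le (hs : Smoothness F D Lu Lv Luv Lvu) (hLu : (Lu : ℝ) ≤ L)
    (hLv : (Lv : ℝ) ≤ L) (hLuv : (Luv : ℝ) ≤ L) (i : Fin n) (u u' : Vec du) (v v' : Vec dv) :
    localObj F (D i) u' v' ≤ localObj F (D i) u v
      + inner ℝ (gradU (localObj F (D i)) u v) (u' - u)
      + inner ℝ (gradV (localObj F (D i)) u v) (v' - v)
      + L * ‖u' - u‖ ^ 2 + L * ‖v' - v‖ ^ 2 := by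
  have h1 : localObj F (D i) u' v' ≤ localObj F (D i) u v'
      + inner ℝ (gradU (localObj F (D i)) u v') (u' - u) + Lu / 2 * ‖u' - u‖ ^ 2 :=
    le_add_inner_add_of_lipschitzWith_gradient (hs.differentiable_u i v') (hs.lipschitz_uu i v') u u'
  have h2 : localObj F (D i) u v' ≤ localObj F (D i) u v
      + inner ℝ (gradV (localObj F (D i)) u v) (v' - v) + Lv / 2 * ‖v' - v‖ ^ 2 :=
    le_add_inner_add_of_lipschitzWith_gradient (hs.differentiable_v i u) (hs.lipschitz_vv i u) v v'
  have h3 : inner ℝ (gradU (localObj F (D i)) u v') (u' - u)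
      ≤ inner ℝ (gradU (localObj F (D i)) u v) (u' - u) + L * ‖v' - v‖ * ‖u' - u‖ := by
    have h4 := real_inner_le_norm
      (gradU (localObj F (D i)) u v' - gradU (localObj F (D i)) u v) (u' - u)
    rw [inner_sub_left] at h4
    have h5 : ‖gradU (localObj F (D i)) u v' - gradU (localObj F (D i)) u v‖ ≤ L * ‖v' - v‖ :=
      ((hs.lipschitz_uv i u).norm_sub_le v' v).trans (by gcongr)
    nlinarith [mul_le_mul_of_nonneg_right h5 (norm_nonneg (u' - u))]
  have hL : 0 ≤ L := Lu.coe_nonneg.trans hLu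
  nlinarith [mul_nonneg hL (sq_nonneg (‖u' - u‖ - ‖v' - v‖)),
    mul_le_mul_of_nonneg_right hLu (sq_nonneg ‖u' - u‖),
    mul_le_mul_of_nonneg_right hLv (sq_nonneg ‖v' - v‖)]

theorem Smoothness.globalObj_le (hs : Smoothness F D Lu Lv Luv Lvu) (hn : 1 ≤ n)
    (hLu : (Lu : ℝ) ≤ L) (hLv : (Lv : ℝ) ≤ L) (hLuv : (Luv : ℝ) ≤ L) (u u' : Vec du)
    (v v' : Fin n → Vec dv) :
    globalObj F D u' v' ≤ globalObj F D u v
      + (inner ℝ (globalGradU F D u v) (u' - u) + L * ‖u' - u‖ ^ 2)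
      + 1 / (n : ℝ) * ∑ i, (inner ℝ (gradV (localObj F (D i)) u (v i)) (v' i - v i)
        + L * ‖v' i - v i‖ ^ 2) := by
  have hn' : (0 : ℝ) < n := by exact_mod_cast hn
  have h := mul_le_mul_of_nonneg_left (Finset.sum_le_sum fun i (_ : i ∈ Finset.univ) =>
    hs.localObj_le hLu hLv hLuv i u u' (v i) (v' i)) (by positivity : 0 ≤ 1 / (n : ℝ))
  refine h.trans_eq ?_
  rw [hs.globalGradU_eq, real_inner_smul_left, sum_inner, globalObj]
  simp only [Finset.sum_add_distrib, Finset.sum_const, Finset.card_univ, Fintype.card_fin,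
    nsmul_eq_mul]
  field_simp
  ring

theorem Smoothness.measurable_localObj (hs : Smoothness F D Lu Lv Luv Lvu) (i : Fin n) :
    Measurable fun p : Vec du × Vec dv => localObj F (D i) p.1 p.2 :=
  measurable_uncurry_of_continuous_of_measurable
    (fun v => (hs.differentiable_u i v).continuous)
    fun u => (hs.differentiable_v i u).continuous.measurable

theorem Smoothness.measurable_globalObj (hs : Smoothness F D Lu Lv Luv Lvu) :
    Measurable fun p : Vec du × (Fin n → Vec dv) => globalObj F D p.1 p.2 :=
  (Finset.measurable_sum _ fun i _ => (hs.measurable_localObj i).comp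
    (measurable_fst.prodMk ((measurable_pi_apply i).comp measurable_snd))).const_mul _

end Objective

/-! ### Expected decrease in one round, for a fixed set of clients -/

section Step

variable {ι E : Type*} [NormedAddCommGroup E] [InnerProductSpace ℝ E]

/-- Common estimate for both variables: u uses the sampled set with `c` the global gradient, and v_i
uses a singleton with `c` its own gradient. Young's inequality with weight K handles ⟨c, M⟩, so that
half of the main decrease is kept; the noise N stays linear in order to vanish in expectation. -/
theorem inner_add_sq_step_le (A : Finset ι) (hA : 1 ≤ A.card) (c : E) (g N M : ι → E) {L γ K : ℝ}
    (hL : 0 ≤ L) (hγ : 0 ≤ γ) (hK : 0 < K) :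
    inner ℝ c (-(γ / A.card) • ∑ i ∈ A, (N i + M i + K • g i))
        + L * ‖-(γ / A.card) • ∑ i ∈ A, (N i + M i + K • g i)‖ ^ 2
      ≤ γ / A.card * ∑ i ∈ A, (-inner ℝ c (N i) - K * inner ℝ c (g i) + K / 2 * ‖c‖ ^ 2
          + 1 / (2 * K) * ‖M i‖ ^ 2)
        + L * γ ^ 2 / A.card ^ 2 * (2 * ‖∑ i ∈ A, N i‖ ^ 2 + 4 * K ^ 2 * ‖∑ i ∈ A, g i‖ ^ 2
          + 4 * A.card * ∑ i ∈ A, ‖M i‖ ^ 2) := by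
  have hA' : (0 : ℝ) < A.card := by exact_mod_cast hA
  refine add_le_add ?_ ?_
  · rw [real_inner_smul_right, inner_sum, neg_mul, ← mul_neg, ← Finset.sum_neg_distrib]
    refine mul_le_mul_of_nonneg_left (Finset.sum_le_sum fun i _ => ?_) (by positivity)
    rw [inner_add_right, inner_add_right, real_inner_smul_right]
    have h1 := abs_le.1 (abs_real_inner_le_norm c (M i))
    have h2 : 0 ≤ 1 / (2 * K) * (K * ‖c‖ - ‖M i‖) ^ 2 := by positivity
    have h3 : 1 / (2 * K) * (K * ‖c‖ - ‖M i‖) ^ 2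
        = K / 2 * ‖c‖ ^ 2 - ‖c‖ * ‖M i‖ + 1 / (2 * K) * ‖M i‖ ^ 2 := by
      field_simp
      ring
    linarith [h1.1]
  · rw [norm_smul, mul_pow, norm_neg, Real.norm_of_nonneg (by positivity), div_pow]
    have h1 : ‖∑ i ∈ A, (N i + M i + K • g i)‖ ^ 2 ≤ 2 * ‖∑ i ∈ A, N i‖ ^ 2
        + 4 * K ^ 2 * ‖∑ i ∈ A, g i‖ ^ 2 + 4 * A.card * ∑ i ∈ A, ‖M i‖ ^ 2 := by
      simp only [add_assoc, Finset.sum_add_distrib, ← Finset.smul_sum]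
      have h2 := norm_add_sq_le_two_mul (∑ i ∈ A, N i) (∑ i ∈ A, M i + K • ∑ i ∈ A, g i)
      have h3 := norm_add_sq_le_two_mul (∑ i ∈ A, M i) (K • ∑ i ∈ A, g i)
      have h4 := norm_sum_sq_le_card_mul A M
      rw [norm_smul, mul_pow, Real.norm_eq_abs, sq_abs] at h3
      linarith
    calc L * (γ ^ 2 / (A.card : ℝ) ^ 2 * ‖∑ i ∈ A, (N i + M i + K • g i)‖ ^ 2)
        = L * γ ^ 2 / (A.card : ℝ) ^ 2 * ‖∑ i ∈ A, (N i + M i + K • g i)‖ ^ 2 := by ring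
      _ ≤ _ := mul_le_mul_of_nonneg_left h1 (by positivity)

theorem integral_inner_add_sq_step_le {Ω : Type*} [MeasurableSpace Ω] {P : Measure Ω}
    [IsProbabilityMeasure P] (A : Finset ι) (hA : 1 ≤ A.card) (c : E) (g : ι → E)
    (N M : ι → Ω → E) {L γ K s : ℝ} {d : ι → ℝ}
    (hL : 0 ≤ L) (hγ : 0 ≤ γ) (hK : 0 < K)
    (hN : ∀ i, MemLp (N i) 2 P) (hM : ∀ i, MemLp (M i) 2 P)
    (hN0 : ∀ i, ∫ ω, inner ℝ c (N i ω) ∂P = 0)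
    (hN2 : ∫ ω, ‖∑ i ∈ A, N i ω‖ ^ 2 ∂P ≤ A.card * K * s)
    (hM2 : ∀ i, ∫ ω, ‖M i ω‖ ^ 2 ∂P ≤ 2 * K * L ^ 2 * d i) :
    Integrable (fun ω => inner ℝ c (-(γ / A.card) • ∑ i ∈ A, (N i ω + M i ω + K • g i))
        + L * ‖-(γ / A.card) • ∑ i ∈ A, (N i ω + M i ω + K • g i)‖ ^ 2) P ∧
    ∫ ω, (inner ℝ c (-(γ / A.card) • ∑ i ∈ A, (N i ω + M i ω + K • g i))
        + L * ‖-(γ / A.card) • ∑ i ∈ A, (N i ω + M i ω + K • g i)‖ ^ 2) ∂P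
      ≤ γ / A.card * ∑ i ∈ A, (-K * inner ℝ c (g i) + K / 2 * ‖c‖ ^ 2 + L ^ 2 * d i)
        + L * γ ^ 2 / A.card ^ 2 * (2 * (A.card * K * s) + 4 * K ^ 2 * ‖∑ i ∈ A, g i‖ ^ 2
          + 4 * A.card * ∑ i ∈ A, 2 * K * L ^ 2 * d i) := by
  have hA' : (0 : ℝ) < A.card := by exact_mod_cast hA
  have hZ : MemLp (fun ω => -(γ / (A.card : ℝ)) • ∑ i ∈ A, (N i ω + M i ω + K • g i)) 2 P :=
    (memLp_finsetSum _ fun i _ => ((hN i).add (hM i)).add (memLp_const _)).const_smul _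
  have hinner : ∀ {f : Ω → E}, MemLp f 2 P → Integrable (fun ω => (inner ℝ c (f ω) : ℝ)) P :=
    fun hf => (hf.integrable one_le_two).const_inner c
  have hint := (hinner hZ).add ((hZ.integrable_norm_pow two_ne_zero).const_mul L)
  refine ⟨hint, ?_⟩
  have iM : ∀ i, Integrable (fun ω => ‖M i ω‖ ^ 2) P :=
    fun i => (hM i).integrable_norm_pow two_ne_zero
  have iMs : Integrable (fun ω => ∑ i ∈ A, ‖M i ω‖ ^ 2) P := integrable_finsetSum _ fun i _ => iM i
  have iN : Integrable (fun ω => ‖∑ i ∈ A, N i ω‖ ^ 2) P :=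
    (memLp_finsetSum _ fun i _ => hN i).integrable_norm_pow two_ne_zero
  have i1 : ∀ i, Integrable (fun ω => -inner ℝ c (N i ω) - K * inner ℝ c (g i)
      + K / 2 * ‖c‖ ^ 2 + 1 / (2 * K) * ‖M i ω‖ ^ 2) P := fun i =>
    ((((hinner (hN i)).neg).sub (integrable_const _)).add (integrable_const _)).add
      ((iM i).const_mul _)
  have e1 : ∀ i, ∫ ω, (-inner ℝ c (N i ω) - K * inner ℝ c (g i)
      + K / 2 * ‖c‖ ^ 2 + 1 / (2 * K) * ‖M i ω‖ ^ 2) ∂P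
      ≤ -K * inner ℝ c (g i) + K / 2 * ‖c‖ ^ 2 + L ^ 2 * d i := by
    intro i
    have h : ∀ ω, -inner ℝ c (N i ω) - K * inner ℝ c (g i)
        + K / 2 * ‖c‖ ^ 2 + 1 / (2 * K) * ‖M i ω‖ ^ 2
        = -inner ℝ c (N i ω) + ((-K * inner ℝ c (g i) + K / 2 * ‖c‖ ^ 2)
          + 1 / (2 * K) * ‖M i ω‖ ^ 2) := fun ω => by ring
    simp_rw [h]
    have h' : Integrable (fun ω => (-K * inner ℝ c (g i) + K / 2 * ‖c‖ ^ 2)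
        + 1 / (2 * K) * ‖M i ω‖ ^ 2) P := (integrable_const _).add ((iM i).const_mul _)
    rw [integral_add (by exact (hinner (hN i)).neg) h',
      integral_add (integrable_const _) ((iM i).const_mul _), integral_neg, hN0,
      integral_const_mul, integral_const, probReal_univ, one_smul]
    have := mul_le_mul_of_nonneg_left (hM2 i) (by positivity : 0 ≤ 1 / (2 * K))
    have e : 1 / (2 * K) * (2 * K * L ^ 2 * d i) = L ^ 2 * d i := by field_simp
    linarith
  have i2 : Integrable (fun ω => 2 * ‖∑ i ∈ A, N i ω‖ ^ 2 + 4 * K ^ 2 * ‖∑ i ∈ A, g i‖ ^ 2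
      + 4 * A.card * ∑ i ∈ A, ‖M i ω‖ ^ 2) P :=
    ((iN.const_mul 2).add (integrable_const _)).add (iMs.const_mul _)
  have e2 : ∫ ω, (2 * ‖∑ i ∈ A, N i ω‖ ^ 2 + 4 * K ^ 2 * ‖∑ i ∈ A, g i‖ ^ 2
      + 4 * A.card * ∑ i ∈ A, ‖M i ω‖ ^ 2) ∂P ≤ 2 * (A.card * K * s)
        + 4 * K ^ 2 * ‖∑ i ∈ A, g i‖ ^ 2 + 4 * A.card * ∑ i ∈ A, 2 * K * L ^ 2 * d i := by
    have i3 : Integrable (fun ω => 2 * ‖∑ i ∈ A, N i ω‖ ^ 2 + 4 * K ^ 2 * ‖∑ i ∈ A, g i‖ ^ 2) P :=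
      (iN.const_mul 2).add (integrable_const _)
    rw [integral_add i3 (iMs.const_mul _), integral_add (iN.const_mul 2) (integrable_const _),
      integral_const_mul, integral_const_mul (4 * (A.card : ℝ)), integral_const, probReal_univ,
      one_smul, integral_finsetSum _ fun i _ => iM i]
    gcongr with i
    exact hM2 i
  refine (integral_mono hint
    (((integrable_finsetSum A fun i _ => i1 i).const_mul (γ / A.card)).add
      (i2.const_mul (L * γ ^ 2 / A.card ^ 2)))
    fun ω => inner_add_sq_step_le A hA c g (fun i => N i ω) (fun i => M i ω) hL hγ hK).trans ?_
  rw [integral_add' ((integrable_finsetSum A fun i _ => i1 i).const_mul (γ / A.card))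
    (i2.const_mul (L * γ ^ 2 / A.card ^ 2)), integral_const_mul, integral_const_mul,
    integral_finsetSum _ fun i _ => i1 i]
  refine add_le_add (mul_le_mul_of_nonneg_left (Finset.sum_le_sum fun i _ => e1 i) (by positivity))
    (mul_le_mul_of_nonneg_left e2 (by positivity))

end Step

/-! ### One round of the algorithm -/

/-- One round of FedAvg-P with client set `A` and samples `x`. -/
noncomputable def roundStep {du dv n : ℕ} {Ξ : Type*} (F : Vec du → Vec dv → Ξ → ℝ) (m K : ℕ)
    (γu γv ηu ηv : ℝ) (A : Finset (Fin n)) (x : Fin n → ℕ → Ξ)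
    (s : Vec du × (Fin n → Vec dv)) : Vec du × (Fin n → Vec dv) :=
  let loc : Fin n → Vec du × Vec dv := fun i => localIter F γu γv (x i) (s.1, s.2 i) K
  ((1 - ηu) • s.1 + (ηu / (m : ℝ)) • ∑ i ∈ A, (loc i).1,
    fun i => if i ∈ A then (1 - ηv) • s.2 i + ηv • (loc i).2 else s.2 i)

/-- Squared gradient norm that is controlled by the algorithm. -/
noncomputable def gradSq {du dv n : ℕ} {Ξ : Type*} [MeasurableSpace Ξ]
    (F : Vec du → Vec dv → Ξ → ℝ) (D : Fin n → Measure Ξ) (m : ℕ)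
    (s : Vec du × (Fin n → Vec dv)) : ℝ :=
  ‖globalGradU F D s.1 s.2‖ ^ 2
    + (m : ℝ) / (n : ℝ) ^ 2 * ∑ i, ‖gradV (localObj F (D i)) s.1 (s.2 i)‖ ^ 2

/-- Here r = m/n, G and W are the squared gradients in u and (averaged) in v, B is the sampling
variance, p and w are the noise variances, Y is the allowance for b², and d is the average drift.
Everything is expressed through q = γLK ≤ 1/32. -/
theorem round_average_numeric {L K γ r G W B p w Y d : ℝ} (hL : 0 ≤ L) (hK : 0 ≤ K) (hγ : 0 ≤ γ)
    (h32 : 32 * (γ * L * K) ≤ 1) (hr : 0 ≤ r) (hr1 : r ≤ 1) (hG : 0 ≤ G) (hW : 0 ≤ W)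
    (hB : 0 ≤ B) (hp : 0 ≤ p) (hw : 0 ≤ w) (hY : 0 ≤ Y) (hd : 0 ≤ d)
    (hdrift : d ≤ K * (2 * K * (γ ^ 2 * (p + w)) + 4 * K ^ 2 * (γ ^ 2 * (Y + (G + r * W)))
      + 8 * K * L ^ 2 * (2 * γ ^ 2) * d)) :
    γ * (-K * G + K / 2 * G + L ^ 2 * d)
      + L * γ ^ 2 * (2 * K * p + 4 * K ^ 2 * (G + B) + 8 * K * L ^ 2 * d)
      + (γ * (-(K / 2 * (r * W)) + r * (L ^ 2 * d))
        + L * γ ^ 2 * (2 * K * w + 4 * K ^ 2 * (r * W) + 8 * K * L ^ 2 * (r * d)))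
      ≤ -(γ * K / 4) * (G + r * W) + 3 * L * K * γ ^ 2 * (2 * K * B + p + w) + γ * K * Y / 4 := by
  set q := γ * L * K with hq
  have hq0 : 0 ≤ q := by positivity
  have hq2 : q ^ 2 ≤ 1 / 1024 := by nlinarith
  set Z := γ * L ^ 2 * d with hZ
  have hZ0 : 0 ≤ Z := by positivity
  set a := L * K * γ ^ 2 * (p + w) with ha
  have ha0 : 0 ≤ a := by positivity
  set X := G + r * W with hX
  have hX0 : 0 ≤ X := by positivity
  set e := γ * K * (Y + X) with he
  have he0 : 0 ≤ e := by positivity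
  -- The implicit drift bound in normalized form. As 16q² ≤ 1/64, the last term is absorbed and Z is
  -- a small multiple of a and e; this turns -1/2 into -1/4 and 2a into 3a at the end.
  have h1 : Z ≤ 2 * q * a + 4 * q ^ 2 * e + 16 * q ^ 2 * Z := by
    have := mul_le_mul_of_nonneg_left hdrift (by positivity : 0 ≤ γ * L ^ 2)
    refine this.trans_eq ?_
    simp only [hq, hZ, ha, he]
    ring
  have h2 : q * a ≤ a / 32 := by nlinarith
  have h3 : q ^ 2 * e ≤ e / 1024 := by nlinarith
  have h4 : q ^ 2 * Z ≤ Z / 1024 := by nlinarith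
  have h5 : q * Z ≤ Z / 32 := by nlinarith
  have h6 : q * (γ * K * X) ≤ γ * K * X / 32 := by
    have : 0 ≤ γ * K * X := by positivity
    nlinarith
  have h7 : r * (Z + 8 * (q * Z)) ≤ Z + 8 * (q * Z) :=
    mul_le_of_le_one_left (by positivity) hr1
  have h8 : 0 ≤ L * K * γ ^ 2 * (2 * K * B) := by positivity
  have e1 : γ * (-K * G + K / 2 * G + L ^ 2 * d)
      + L * γ ^ 2 * (2 * K * p + 4 * K ^ 2 * (G + B) + 8 * K * L ^ 2 * d)
      + (γ * (-(K / 2 * (r * W)) + r * (L ^ 2 * d))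
        + L * γ ^ 2 * (2 * K * w + 4 * K ^ 2 * (r * W) + 8 * K * L ^ 2 * (r * d)))
      = -(γ * K * X / 2) + 4 * (q * (γ * K * X)) + 2 * a + 2 * (L * K * γ ^ 2 * (2 * K * B))
        + (Z + 8 * (q * Z)) + r * (Z + 8 * (q * Z)) := by
    simp only [hq, hZ, ha, hX]
    ring
  have e2 : -(γ * K / 4) * X + 3 * L * K * γ ^ 2 * (2 * K * B + p + w) + γ * K * Y / 4
      = -(γ * K * X / 4) + 3 * a + 3 * (L * K * γ ^ 2 * (2 * K * B)) + γ * K * Y / 4 := by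
    simp only [ha]
    ring
  have e3 : e = γ * K * Y + γ * K * X := by rw [he]; ring
  have hYX : 0 ≤ γ * K * Y ∧ 0 ≤ γ * K * X := ⟨by positivity, by positivity⟩
  rw [e1, e2]
  linarith [hYX.1, hYX.2]

theorem sum_const_mul_add {n : ℕ} (hn : (n : ℝ) ≠ 0) {a h d : Fin n → ℝ}
    {γ p q m K G L s : ℝ} :
    ∑ i, (p * (-K * a i + K / 2 * G + L ^ 2 * d i) + q * (4 * m * (2 * K * L ^ 2 * d i))
        + 1 / n * (γ * (-(K / 2 * h i) + L ^ 2 * d i)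
        + L * γ ^ 2 * (2 * (K * s) + 4 * K ^ 2 * h i + 4 * (2 * K * L ^ 2 * d i))))
      = -(p * K) * ∑ i, a i + n * (p * (K / 2 * G) + 1 / n * (L * γ ^ 2 * (2 * (K * s)))
        + (1 / n * (-(γ * (K / 2)) + L * γ ^ 2 * (4 * K ^ 2))) * (1 / n * ∑ i, h i)
        + (p * L ^ 2 + q * (4 * m * (2 * K * L ^ 2))
          + 1 / n * (γ * L ^ 2 + L * γ ^ 2 * (4 * (2 * K * L ^ 2)))) * (1 / n * ∑ i, d i)) := by
  have e : ∀ i, p * (-K * a i + K / 2 * G + L ^ 2 * d i) + q * (4 * m * (2 * K * L ^ 2 * d i))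
      + 1 / n * (γ * (-(K / 2 * h i) + L ^ 2 * d i)
      + L * γ ^ 2 * (2 * (K * s) + 4 * K ^ 2 * h i + 4 * (2 * K * L ^ 2 * d i)))
      = -(p * K) * a i + (p * (K / 2 * G) + 1 / n * (L * γ ^ 2 * (2 * (K * s))))
        + (1 / n * (-(γ * (K / 2)) + L * γ ^ 2 * (4 * K ^ 2))) * h i
        + (p * L ^ 2 + q * (4 * m * (2 * K * L ^ 2))
          + 1 / n * (γ * L ^ 2 + L * γ ^ 2 * (4 * (2 * K * L ^ 2)))) * d i := fun i => by ring
  simp_rw [e]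
  simp only [Finset.sum_add_distrib, ← Finset.mul_sum, Finset.sum_const, Finset.card_univ,
    Fintype.card_fin, nsmul_eq_mul]
  field_simp
  ring

theorem average_const_mul_add {n : ℕ} (hn : (n : ℝ) ≠ 0) {a h d : Fin n → ℝ}
    {K s p q c e : ℝ} :
    1 / (n : ℝ) * ∑ i, K * (s + c * (p * a i + q * h i) + e * d i)
      = K * (s + c * (p * (1 / n * ∑ i, a i) + q * (1 / n * ∑ i, h i))
        + e * (1 / n * ∑ i, d i)) := by
  simp only [← Finset.mul_sum, Finset.sum_add_distrib, Finset.sum_const,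
    Finset.card_univ, Fintype.card_fin, nsmul_eq_mul]
  field_simp

section Round

variable {du dv n : ℕ} {Ξ Ω : Type*} [MeasurableSpace Ξ] [MeasurableSpace Ω]
  {P : Measure Ω} [IsProbabilityMeasure P] {D : Fin n → Measure Ξ} [∀ i, IsProbabilityMeasure (D i)]
  {F : Vec du → Vec dv → Ξ → ℝ} {Lu Lv Luv Lvu : ℝ≥0} {L σu σv : ℝ} {x : Fin n → ℕ → Ω → Ξ}
  (γu γv : ℝ) (u : Vec du) (v : Fin n → Vec dv)

omit [MeasurableSpace Ω] [∀ i, IsProbabilityMeasure (D i)] in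
variable (F D x) in
-- Interpolation scales the averaged local displacement by ηu, so the local step size enters
-- explicitly only through γu ηu = γ; its separate size matters only for the drift.
theorem roundStep_fst_sub {γ ηu : ℝ} (ηv : ℝ) {m : ℕ} (K : ℕ) (hm : 1 ≤ m) (hγu : γu * ηu = γ)
    {A : Finset (Fin n)} (hA : A.card = m) (ω : Ω) :
    (roundStep F m K γu γv ηu ηv A (fun i k => x i k ω) (u, v)).1 - u
      = -(γ / (A.card : ℝ)) • ∑ i ∈ A, (∑ j ∈ Finset.range K, stepNoiseU γu γv u v F D x i j ω
        + ∑ j ∈ Finset.range K, gradDriftU γu γv u v F D x i j ω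
        + (K : ℝ) • gradU (localObj F (D i)) u (v i)) := by
  have hm' : (m : ℝ) ≠ 0 := by positivity
  have h : (roundStep F m K γu γv ηu ηv A (fun i k => x i k ω) (u, v)).1
      = (1 - ηu) • u + (ηu / (m : ℝ)) • ∑ i ∈ A, (localPath F γu γv x u v i K ω).1 := rfl
  rw [h]
  simp only [localPath_fst D F, Finset.sum_sub_distrib, Finset.sum_const, hA, ← Finset.smul_sum,
    ← Nat.cast_smul_eq_nsmul ℝ, ← hγu]
  rw [smul_sub, smul_smul, smul_smul, div_mul_cancel₀ _ hm',
    show ηu / (m : ℝ) * γu = γu * ηu / m by ring]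
  module

omit [MeasurableSpace Ω] [∀ i, IsProbabilityMeasure (D i)] in
variable (F D x) in
theorem roundStep_snd_sub {γ ηv : ℝ} (ηu : ℝ) (m K : ℕ) (hγv : γv * ηv = γ)
    (A : Finset (Fin n)) (i : Fin n) (ω : Ω) :
    (roundStep F m K γu γv ηu ηv A (fun i k => x i k ω) (u, v)).2 i - v i
      = if i ∈ A then -γ • (∑ j ∈ Finset.range K, stepNoiseV γu γv u v F D x i j ω
        + ∑ j ∈ Finset.range K, gradDriftV γu γv u v F D x i j ω
        + (K : ℝ) • gradV (localObj F (D i)) u (v i)) else 0 := by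
  have h : (roundStep F m K γu γv ηu ηv A (fun i k => x i k ω) (u, v)).2 i
      = if i ∈ A then (1 - ηv) • v i + ηv • (localPath F γu γv x u v i K ω).2 else v i := rfl
  rw [h]
  split_ifs
  · rw [localPath_snd D F, ← hγv]
    module
  · simp

/-- Upper bound for the expected change of the objective in one round with client set `A`. -/
noncomputable def roundBound (F : Vec du → Vec dv → Ξ → ℝ) (D : Fin n → Measure Ξ)
    (P : Measure Ω) (x : Fin n → ℕ → Ω → Ξ) (L σu σv γ : ℝ) (K : ℕ) (A : Finset (Fin n)) : ℝ :=
  γ / A.card * ∑ i ∈ A, (-K * inner ℝ (globalGradU F D u v) (gradU (localObj F (D i)) u (v i))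
      + K / 2 * ‖globalGradU F D u v‖ ^ 2 + L ^ 2 * drift γu γv u v F P x K i)
    + L * γ ^ 2 / A.card ^ 2 * (2 * (A.card * K * σu ^ 2)
      + 4 * K ^ 2 * ‖∑ i ∈ A, gradU (localObj F (D i)) u (v i)‖ ^ 2
      + 4 * A.card * ∑ i ∈ A, 2 * K * L ^ 2 * drift γu γv u v F P x K i)
    + 1 / n * ∑ i ∈ A, (γ * (-(K / 2 * ‖gradV (localObj F (D i)) u (v i)‖ ^ 2)
        + L ^ 2 * drift γu γv u v F P x K i)
      + L * γ ^ 2 * (2 * (K * σv ^ 2) + 4 * K ^ 2 * ‖gradV (localObj F (D i)) u (v i)‖ ^ 2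
        + 4 * (2 * K * L ^ 2 * drift γu γv u v F P x K i)))

theorem measurable_roundStep
    (hu : Measurable (fun p : Vec du × Vec dv × Ξ => gradU (fun u v => F u v p.2.2) p.1 p.2.1))
    (hv : Measurable (fun p : Vec du × Vec dv × Ξ => gradV (fun u v => F u v p.2.2) p.1 p.2.1))
    (m K : ℕ) (ηu ηv : ℝ) (A : Finset (Fin n)) :
    Measurable fun p : (Vec du × (Fin n → Vec dv)) × (Fin n → ℕ → Ξ) =>
      roundStep F m K γu γv ηu ηv A p.2 p.1 := by
  have hloc : ∀ (i : Fin n) (k : ℕ), Measurable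
      fun p : (Vec du × (Fin n → Vec dv)) × (Fin n → ℕ → Ξ) =>
        localIter F γu γv (p.2 i) (p.1.1, p.1.2 i) k := by
    intro i k
    induction k with
    | zero => exact measurable_fst.fst.prodMk ((measurable_pi_apply i).comp measurable_fst.snd)
    | succ k ih =>
      have hx : Measurable fun p : (Vec du × (Fin n → Vec dv)) × (Fin n → ℕ → Ξ) => p.2 i k :=
        (measurable_pi_apply k).comp ((measurable_pi_apply i).comp measurable_snd)
      have hq := ih.fst.prodMk (ih.snd.prodMk hx)
      exact (ih.fst.sub ((hu.comp hq).const_smul γu)).prodMk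
        (ih.snd.sub ((hv.comp hq).const_smul γv))
  refine Measurable.prodMk ?_ (measurable_pi_lambda _ fun i => ?_)
  · exact (measurable_fst.fst.const_smul (1 - ηu)).add
      ((Finset.measurable_sum A fun i _ => (hloc i K).fst).const_smul (ηu / (m : ℝ)))
  · have hvi : Measurable fun p : (Vec du × (Fin n → Vec dv)) × (Fin n → ℕ → Ξ) => p.1.2 i :=
      (measurable_pi_apply i).comp measurable_fst.snd
    by_cases hi : i ∈ A
    · simp only [hi, if_true]
      exact (hvi.const_smul (1 - ηv)).add ((hloc i K).snd.const_smul ηv)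
    · simpa only [hi, if_false] using hvi

theorem RoundAssumptions.integral_globalObj_roundStep_le
    (hR : RoundAssumptions F D Lu Lv Luv Lvu L σu σv P x) {γ ηu ηv : ℝ} {m K : ℕ} (hm : 1 ≤ m)
    (hK : 1 ≤ K) (hγ : 0 ≤ γ) (hγu : γu * ηu = γ) (hγv : γv * ηv = γ)
    {A : Finset (Fin n)} (hA : A.card = m) {c : ℝ} (hc : ∀ u v, c ≤ globalObj F D u v) :
    Integrable (fun ω =>
      globalObj F D (roundStep F m K γu γv ηu ηv A (fun i k => x i k ω) (u, v)).1
        (roundStep F m K γu γv ηu ηv A (fun i k => x i k ω) (u, v)).2) P ∧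
    ∫ ω, globalObj F D (roundStep F m K γu γv ηu ηv A (fun i k => x i k ω) (u, v)).1
        (roundStep F m K γu γv ηu ηv A (fun i k => x i k ω) (u, v)).2 ∂P
      ≤ globalObj F D u v + roundBound γu γv u v F D P x L σu σv γ K A := by
  have hn : 1 ≤ n := hm.trans (hA ▸ card_finset_fin_le A)
  have hn' : (0 : ℝ) < n := by exact_mod_cast hn
  have hK' : (0 : ℝ) < K := by exact_mod_cast hK
  have hL : 0 ≤ L := Lu.coe_nonneg.trans hR.le_u
  -- Cauchy–Schwarz over the K steps, bringing the gradient drift to the form 2KL²d that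
  -- `integral_inner_add_sq_step_le` expects.
  have hsum : ∀ {E : Type} [NormedAddCommGroup E] [InnerProductSpace ℝ E]
      {a : Fin n → ℕ → Ω → E} {r : ℝ}, (∀ i j, MemLp (a i j) 2 P) → ∀ i,
      ∑ j ∈ Finset.range K, ∫ ω, ‖a i j ω‖ ^ 2 ∂P ≤ 2 * L ^ 2 * r →
      ∫ ω, ‖∑ j ∈ Finset.range K, a i j ω‖ ^ 2 ∂P ≤ 2 * K * L ^ 2 * r := by
    intro E _ _ a r ha i hr
    have h1 : ∀ j, Integrable (fun ω => ‖a i j ω‖ ^ 2) P :=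
      fun j => (ha i j).integrable_norm_pow two_ne_zero
    calc _ ≤ ∫ ω, (K : ℝ) * ∑ j ∈ Finset.range K, ‖a i j ω‖ ^ 2 ∂P := by
          refine integral_mono ((memLp_finsetSum _ fun j _ => ha i j).integrable_norm_pow
            two_ne_zero) ((integrable_finsetSum _ fun j _ => h1 j).const_mul _) fun ω => ?_
          simpa using norm_sum_sq_le_card_mul (Finset.range K) fun j => a i j ω
      _ = K * ∑ j ∈ Finset.range K, ∫ ω, ‖a i j ω‖ ^ 2 ∂P := by
          rw [integral_const_mul, integral_finsetSum _ fun j _ => h1 j]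
      _ ≤ K * (2 * L ^ 2 * r) := by gcongr
      _ = _ := by ring
  have hU := integral_inner_add_sq_step_le (P := P) A (hA ▸ hm) (globalGradU F D u v)
    (fun i => gradU (localObj F (D i)) u (v i))
    (fun i ω => ∑ j ∈ Finset.range K, stepNoiseU γu γv u v F D x i j ω)
    (fun i ω => ∑ j ∈ Finset.range K, gradDriftU γu γv u v F D x i j ω)
    (s := σu ^ 2) (d := drift γu γv u v F P x K) hL hγ hK'
    (fun i => memLp_finsetSum _ fun j _ => hR.memLp_stepNoiseU γu γv u v i j)
    (fun i => memLp_finsetSum _ fun j _ => hR.memLp_gradDriftU γu γv u v i j)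
    (fun i => by
      simp_rw [inner_sum]
      rw [integral_finsetSum _ fun j _ =>
        ((hR.memLp_stepNoiseU γu γv u v i j).integrable one_le_two).const_inner _]
      exact Finset.sum_eq_zero fun j _ =>
        (isNoise_noiseU hR.smooth hR.stochastic).integral_inner_const hR.stochastic.measurable_u
          hR.stochastic.measurable_v hR.sample i j _)
    (hR.integral_norm_sq_sum_stepNoiseU_le γu γv u v A K)
    (fun i => hsum (hR.memLp_gradDriftU γu γv u v) i
      (hR.sum_integral_norm_sq_gradDriftU_le γu γv u v i K))
  have hV := fun i : Fin n => integral_inner_add_sq_step_le (P := P) {i} (by simp)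
    (gradV (localObj F (D i)) u (v i))
    (fun i => gradV (localObj F (D i)) u (v i))
    (fun i ω => ∑ j ∈ Finset.range K, stepNoiseV γu γv u v F D x i j ω)
    (fun i ω => ∑ j ∈ Finset.range K, gradDriftV γu γv u v F D x i j ω)
    (s := σv ^ 2) (d := drift γu γv u v F P x K) hL hγ hK'
    (fun i => memLp_finsetSum _ fun j _ => hR.memLp_stepNoiseV γu γv u v i j)
    (fun i => memLp_finsetSum _ fun j _ => hR.memLp_gradDriftV γu γv u v i j)
    (fun i => by
      simp_rw [inner_sum]
      rw [integral_finsetSum _ fun j _ =>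
        ((hR.memLp_stepNoiseV γu γv u v i j).integrable one_le_two).const_inner _]
      exact Finset.sum_eq_zero fun j _ =>
        (isNoise_noiseV hR.smooth hR.stochastic).integral_inner_const hR.stochastic.measurable_u
          hR.stochastic.measurable_v hR.sample i j _)
    (hR.integral_norm_sq_sum_stepNoiseV_le γu γv u v {i} K)
    (fun i => hsum (hR.memLp_gradDriftV γu γv u v) i
      (hR.sum_integral_norm_sq_gradDriftV_le γu γv u v i K))
  simp only [Finset.sum_singleton, Finset.card_singleton, Nat.cast_one, div_one, one_pow, one_mul,
    mul_one, real_inner_self_eq_norm_sq] at hV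
  have hfst := roundStep_fst_sub D F x γu γv u v ηv K hm hγu hA
  have hsnd := roundStep_snd_sub D F x γu γv u v ηu m K hγv A
  simp only [← hfst] at hU
  set st : Ω → Vec du × (Fin n → Vec dv) :=
    fun ω => roundStep F m K γu γv ηu ηv A (fun i k => x i k ω) (u, v) with hst
  set d := drift γu γv u v F P x K
  have hst_meas : Measurable st :=
    (measurable_roundStep γu γv hR.stochastic.measurable_u hR.stochastic.measurable_v m K ηu ηv
      A).comp (measurable_const.prodMk (measurable_pi_lambda _ fun i => measurable_pi_lambda _
        fun k => hR.sample.measurable i k))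
  have hVi : ∀ i, Integrable (fun ω => inner ℝ (gradV (localObj F (D i)) u (v i))
        ((st ω).2 i - v i) + L * ‖(st ω).2 i - v i‖ ^ 2) P ∧
      ∫ ω, (inner ℝ (gradV (localObj F (D i)) u (v i))
        ((st ω).2 i - v i) + L * ‖(st ω).2 i - v i‖ ^ 2) ∂P ≤
      if i ∈ A then γ * (-(K / 2 * ‖gradV (localObj F (D i)) u (v i)‖ ^ 2) + L ^ 2 * d i)
      + L * γ ^ 2 * (2 * (K * σv ^ 2) + 4 * K ^ 2 * ‖gradV (localObj F (D i)) u (v i)‖ ^ 2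
        + 4 * (2 * K * L ^ 2 * d i)) else 0 := by
    intro i
    by_cases hi : i ∈ A
    · simp only [hst, hsnd, hi, if_true]
      exact ⟨(hV i).1, (hV i).2.trans_eq (by ring)⟩
    · simp [hst, hsnd, hi]
  have hle : ∀ ω, globalObj F D (st ω).1 (st ω).2 ≤ globalObj F D u v
      + (inner ℝ (globalGradU F D u v) ((st ω).1 - u) + L * ‖(st ω).1 - u‖ ^ 2)
      + 1 / (n : ℝ) * ∑ i, (inner ℝ (gradV (localObj F (D i)) u (v i)) ((st ω).2 i - v i)
        + L * ‖(st ω).2 i - v i‖ ^ 2) :=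
    fun ω => hR.smooth.globalObj_le hn hR.le_u hR.le_v hR.le_uv _ _ _ _
  have i1 : Integrable (fun ω => globalObj F D u v
      + (inner ℝ (globalGradU F D u v) ((st ω).1 - u) + L * ‖(st ω).1 - u‖ ^ 2)) P :=
    (integrable_const _).add hU.1
  have i2 : Integrable (fun ω => ∑ i, (inner ℝ (gradV (localObj F (D i)) u (v i))
      ((st ω).2 i - v i) + L * ‖(st ω).2 i - v i‖ ^ 2)) P :=
    integrable_finsetSum _ fun i _ => (hVi i).1
  have i3 := i1.add (i2.const_mul (1 / (n : ℝ)))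
  -- The objective is squeezed between the constant `c` and the integrable quadratic upper bound.
  have i0 : Integrable (fun ω => globalObj F D (st ω).1 (st ω).2) P :=
    integrable_of_le_of_le (hR.smooth.measurable_globalObj.comp hst_meas).aestronglyMeasurable
      (Filter.Eventually.of_forall fun ω => hc _ _) (Filter.Eventually.of_forall hle)
      (integrable_const c) i3
  refine ⟨i0, (integral_mono i0 i3 hle).trans ?_⟩
  rw [integral_add' i1 (i2.const_mul (1 / (n : ℝ))), integral_add (integrable_const _) hU.1,
    integral_const, probReal_univ, one_smul, integral_const_mul,
    integral_finsetSum _ fun i _ => (hVi i).1, roundBound, add_assoc]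
  gcongr
  · exact hU.2
  · refine (Finset.sum_le_sum fun i _ => (hVi i).2).trans_eq ?_
    rw [← Finset.sum_filter, Finset.filter_mem_eq_inter, Finset.univ_inter]

omit [IsProbabilityMeasure P] [MeasurableSpace Ξ] in
theorem drift_nonneg (K : ℕ) (i : Fin n) : 0 ≤ drift γu γv u v F P x K i :=
  Finset.sum_nonneg fun _ _ => integral_nonneg fun _ => by positivity

/-- The step-size conditions rewrite the averaged drift bound in the quantities of the final
estimate: γu² ≤ γ²/m turns σu² into σu²/m, γv² ≤ γ²m/n produces the weight m/n for the v-terms, and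
γu²b² ≤ γ²Y pays for the dissimilarity. -/
theorem RoundAssumptions.average_drift_le
    (hR : RoundAssumptions F D Lu Lv Luv Lvu L σu σv P x) {b γ Y : ℝ} {m K : ℕ} (hm : 1 ≤ m)
    (hmn : m ≤ n) (hb : BoundedDissimilarity F D b) (hγu : γu ^ 2 * m ≤ γ ^ 2)
    (hγub : γu ^ 2 * b ^ 2 ≤ γ ^ 2 * Y) (hγv : γv ^ 2 ≤ γ ^ 2 * (m / n)) {d G W : ℝ}
    (hd : d = 1 / (n : ℝ) * ∑ i, drift γu γv u v F P x K i)
    (hG : G = ‖globalGradU F D u v‖ ^ 2)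
    (hW : W = 1 / (n : ℝ) * ∑ i, ‖gradV (localObj F (D i)) u (v i)‖ ^ 2) :
    d ≤ K * (2 * K * (γ ^ 2 * (σu ^ 2 / m + m / n * σv ^ 2))
      + 4 * K ^ 2 * (γ ^ 2 * (Y + (G + m / n * W))) + 8 * K * L ^ 2 * (2 * γ ^ 2) * d) := by
  have hm' : (1 : ℝ) ≤ m := by exact_mod_cast hm
  have hmn' : (m : ℝ) ≤ n := by exact_mod_cast hmn
  have hm0 : (0 : ℝ) < m := by linarith
  have hn0 : (0 : ℝ) < n := by linarith
  have hr1 : (m : ℝ) / n ≤ 1 := (div_le_one hn0).2 hmn'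
  have hd0 : 0 ≤ d := by
    rw [hd]
    exact mul_nonneg (by positivity) (Finset.sum_nonneg fun i _ => drift_nonneg γu γv u v K i)
  have hG0 : 0 ≤ G := by
    rw [hG]
    exact sq_nonneg _
  have hW0 : 0 ≤ W := by
    rw [hW]
    exact mul_nonneg (by positivity) (Finset.sum_nonneg fun i _ => sq_nonneg _)
  set V := 1 / (n : ℝ) * ∑ i, ‖gradU (localObj F (D i)) u (v i)‖ ^ 2 with hV
  have hVb : V ≤ b ^ 2 + G := by
    rw [hG]
    exact hb u v
  have h1 : d ≤ K * (2 * K * (γu ^ 2 * σu ^ 2 + γv ^ 2 * σv ^ 2)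
      + 4 * K ^ 2 * (γu ^ 2 * V + γv ^ 2 * W) + 8 * K * L ^ 2 * (γu ^ 2 + γv ^ 2) * d) := by
    rw [hd, hV, hW]
    exact (mul_le_mul_of_nonneg_left (Finset.sum_le_sum fun i (_ : i ∈ Finset.univ) =>
      hR.drift_le γu γv u v i K) (by positivity)).trans_eq (average_const_mul_add hn0.ne')
  have h3 : γu ^ 2 * σu ^ 2 ≤ γ ^ 2 * (σu ^ 2 / m) := by
    rw [← mul_div_assoc, le_div_iff₀ hm0]
    nlinarith [mul_le_mul_of_nonneg_right hγu (sq_nonneg σu)]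
  have h4 : γv ^ 2 * σv ^ 2 ≤ γ ^ 2 * (m / n * σv ^ 2) := by
    rw [← mul_assoc]
    exact mul_le_mul_of_nonneg_right hγv (sq_nonneg σv)
  have hγu1 : γu ^ 2 ≤ γ ^ 2 := by nlinarith [sq_nonneg γu]
  have hγv1 : γv ^ 2 ≤ γ ^ 2 := hγv.trans (mul_le_of_le_one_right (sq_nonneg γ) hr1)
  have h5 : γu ^ 2 * V ≤ γ ^ 2 * Y + γ ^ 2 * G := by
    linarith [mul_le_mul_of_nonneg_left hVb (sq_nonneg γu), mul_le_mul_of_nonneg_right hγu1 hG0]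
  have h6 : γv ^ 2 * W ≤ γ ^ 2 * (m / n * W) := by
    rw [← mul_assoc]
    exact mul_le_mul_of_nonneg_right hγv hW0
  refine h1.trans ?_
  gcongr <;> linarith

omit [IsProbabilityMeasure P] [∀ i, IsProbabilityMeasure (D i)] in
-- Separates what is additive over the clients of `A` from the one nonlinear term ‖∑ ∇_u f_i‖²,
-- since the two are averaged over subsets by different lemmas.
theorem roundBound_eq {γ : ℝ} {m K : ℕ} {A : Finset (Fin n)} (hA : A.card = m) :
    roundBound γu γv u v F D P x L σu σv γ K A
      = ∑ i ∈ A, (γ / m * (-K * inner ℝ (globalGradU F D u v) (gradU (localObj F (D i)) u (v i))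
          + K / 2 * ‖globalGradU F D u v‖ ^ 2 + L ^ 2 * drift γu γv u v F P x K i)
        + L * γ ^ 2 / m ^ 2 * (4 * m * (2 * K * L ^ 2 * drift γu γv u v F P x K i))
        + 1 / n * (γ * (-(K / 2 * ‖gradV (localObj F (D i)) u (v i)‖ ^ 2)
          + L ^ 2 * drift γu γv u v F P x K i)
        + L * γ ^ 2 * (2 * (K * σv ^ 2) + 4 * K ^ 2 * ‖gradV (localObj F (D i)) u (v i)‖ ^ 2
          + 4 * (2 * K * L ^ 2 * drift γu γv u v F P x K i))))
        + L * γ ^ 2 / m ^ 2 * (2 * (m * K * σu ^ 2))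
        + 4 * L * γ ^ 2 * K ^ 2 / m ^ 2 * ‖∑ i ∈ A, gradU (localObj F (D i)) u (v i)‖ ^ 2 := by
  have h : ∑ i ∈ A, L * γ ^ 2 / m ^ 2 * (4 * m * (2 * K * L ^ 2 * drift γu γv u v F P x K i))
      = L * γ ^ 2 / m ^ 2 * (4 * m * ∑ i ∈ A, 2 * K * L ^ 2 * drift γu γv u v F P x K i) := by
    simp only [Finset.mul_sum]
  rw [roundBound, hA, Finset.mul_sum A _ (γ / m), Finset.mul_sum A _ (1 / (n : ℝ)),
    Finset.sum_add_distrib, Finset.sum_add_distrib, h]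
  ring

theorem RoundAssumptions.sum_roundBound_le
    (hR : RoundAssumptions F D Lu Lv Luv Lvu L σu σv P x) {b γ Y : ℝ} {m K : ℕ} (hm : 1 ≤ m)
    (hmn : m ≤ n) (hb : BoundedDissimilarity F D b) (hγ : 0 ≤ γ)
    (h32 : 32 * (γ * L * K) ≤ 1) (hY : 0 ≤ Y) (hγu : γu ^ 2 * m ≤ γ ^ 2)
    (hγub : γu ^ 2 * b ^ 2 ≤ γ ^ 2 * Y) (hγv : γv ^ 2 ≤ γ ^ 2 * (m / n)) :
    ∑ A ∈ Finset.powersetCard m Finset.univ, roundBound γu γv u v F D P x L σu σv γ K A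
      ≤ n.choose m * (-(γ * K / 4) * gradSq F D m (u, v)
        + 3 * L * K * γ ^ 2 * (4 * ((n : ℝ) - m) * K * b ^ 2 / (m * n) + σu ^ 2 / m + m * σv ^ 2 / n)
        + γ * K * Y / 4) := by
  have hL : 0 ≤ L := Lu.coe_nonneg.trans hR.le_u
  have hm' : (1 : ℝ) ≤ m := by exact_mod_cast hm
  have hmn' : (m : ℝ) ≤ n := by exact_mod_cast hmn
  have hm0 : (0 : ℝ) < m := by linarith
  have hn0 : (0 : ℝ) < n := by linarith
  have hC : (0 : ℝ) ≤ n.choose m := Nat.cast_nonneg _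
  have hsq := mul_le_mul_of_nonneg_left (sum_powersetCard_norm_sq_sum_le hm hmn
    (fun i => gradU (localObj F (D i)) u (v i)) (globalGradU F D u v)
    (hR.smooth.globalGradU_eq u v) (hb u v))
    (by positivity : 0 ≤ 4 * L * γ ^ 2 * K ^ 2 / (m : ℝ) ^ 2)
  have hinner : ∑ i, inner ℝ (globalGradU F D u v) (gradU (localObj F (D i)) u (v i))
      = n * ‖globalGradU F D u v‖ ^ 2 := by
    rw [← real_inner_self_eq_norm_sq]
    conv_rhs => rw [hR.smooth.globalGradU_eq u v, real_inner_smul_right]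
    rw [inner_sum, hR.smooth.globalGradU_eq u v]
    field_simp
  have hgs : gradSq F D m (u, v) = ‖globalGradU F D u v‖ ^ 2
      + m / n * (1 / n * ∑ i, ‖gradV (localObj F (D i)) u (v i)‖ ^ 2) := by
    rw [gradSq]
    field_simp
  have hdrift := hR.average_drift_le γu γv u v hm hmn hb hγu hγub hγv (K := K) rfl rfl rfl
  have hd0 : 0 ≤ 1 / (n : ℝ) * ∑ i, drift γu γv u v F P x K i :=
    mul_nonneg (by positivity) (Finset.sum_nonneg fun i _ => drift_nonneg γu γv u v K i)
  rw [Finset.sum_congr rfl fun A hA => roundBound_eq γu γv u v (Finset.mem_powersetCard.1 hA).2,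
    Finset.sum_add_distrib, Finset.sum_add_distrib, sum_powersetCard_sum hm hmn,
    sum_const_mul_add hn0.ne', hinner, hgs, Finset.sum_const, Finset.card_powersetCard,
    Finset.card_univ, Fintype.card_fin, nsmul_eq_mul, ← Finset.mul_sum (Finset.powersetCard _ _)]
  refine (add_le_add le_rfl hsq).trans ?_
  have hW0 : 0 ≤ 1 / (n : ℝ) * ∑ i, ‖gradV (localObj F (D i)) u (v i)‖ ^ 2 :=
    mul_nonneg (by positivity) (Finset.sum_nonneg fun i _ => sq_nonneg _)
  have hG0 : 0 ≤ ‖globalGradU F D u v‖ ^ 2 := by positivity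
  generalize 1 / (n : ℝ) * ∑ i, ‖gradV (localObj F (D i)) u (v i)‖ ^ 2 = W at *
  generalize 1 / (n : ℝ) * ∑ i, drift γu γv u v F P x K i = d at *
  generalize ‖globalGradU F D u v‖ ^ 2 = G at *
  clear hinner hgs hsq hb hR
  -- B is the excess 2m(n-m)b²/n of the second moment over subsets, divided by m².
  have hnum := round_average_numeric (B := 2 * (((n : ℝ) - m) / (m * n)) * b ^ 2) hL
    (Nat.cast_nonneg K) hγ h32 (by positivity) ((div_le_one hn0).2 hmn') hG0 hW0
    (by have : (0 : ℝ) ≤ n - m := by linarith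
        positivity) (by positivity : 0 ≤ σu ^ 2 / m)
    (by positivity : 0 ≤ (m : ℝ) / n * σv ^ 2) hY hd0 hdrift
  have e2 : 2 * (K : ℝ) * (2 * (((n : ℝ) - m) / (m * n)) * b ^ 2)
      = 4 * ((n : ℝ) - m) * K * b ^ 2 / (m * n) := by ring
  rw [e2, show (m : ℝ) / n * σv ^ 2 = m * σv ^ 2 / n by ring] at hnum
  refine le_trans (le_of_eq ?_) (mul_le_mul_of_nonneg_left hnum hC)
  field_simp
  ring

end Round

/-! ### Independence of the rounds -/

section Rounds

variable {du dv n : ℕ} {Ξ Ω : Type*} [MeasurableSpace Ξ] [MeasurableSpace Ω]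
  {P : Measure Ω} [IsProbabilityMeasure P] {D : Fin n → Measure Ξ}
  {F : Vec du → Vec dv → Ξ → ℝ} {m K : ℕ} {γu γv ηu ηv : ℝ} {u₀ : Vec du} {v₀ : Fin n → Vec dv}
  {S : ℕ → Ω → Finset (Fin n)} {ξ : ℕ → Fin n → ℕ → Ω → Ξ}

theorem measurable_pi_of_forall {α ι : Type*} {β : ι → Type*} [∀ i, MeasurableSpace (β i)]
    {m' : MeasurableSpace α} {f : α → ∀ i, β i} (h : ∀ i, Measurable[m'] fun a => f a i) :
    Measurable[m'] f :=
  measurable_pi_lambda f h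

omit [MeasurableSpace Ξ] in
theorem iter_succ (S : ℕ → Finset (Fin n)) (x : ℕ → Fin n → ℕ → Ξ) (t : ℕ) :
    iter F m K γu γv ηu ηv S x u₀ v₀ (t + 1)
      = roundStep F m K γu γv ηu ηv (S t) (x t) (iter F m K γu γv ηu ηv S x u₀ v₀ t) := rfl

omit [MeasurableSpace Ξ] in
theorem iter_congr {S S' : ℕ → Finset (Fin n)} {x x' : ℕ → Fin n → ℕ → Ξ} {t : ℕ}
    (hS : ∀ s < t, S s = S' s) (hx : ∀ s < t, x s = x' s) :
    iter F m K γu γv ηu ηv S x u₀ v₀ t = iter F m K γu γv ηu ηv S' x' u₀ v₀ t := by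
  induction t with
  | zero => rfl
  | succ t ih =>
    rw [iter_succ, iter_succ, hS t t.lt_succ_self, hx t t.lt_succ_self,
      ih (fun s hs => hS s (hs.trans t.lt_succ_self)) fun s hs => hx s (hs.trans t.lt_succ_self)]

theorem measurable_iter
    (hu : Measurable (fun p : Vec du × Vec dv × Ξ => gradU (fun u v => F u v p.2.2) p.1 p.2.1))
    (hv : Measurable (fun p : Vec du × Vec dv × Ξ => gradV (fun u v => F u v p.2.2) p.1 p.2.1))
    (t : ℕ) :
    Measurable fun p : (ℕ → Finset (Fin n)) × (ℕ → Fin n → ℕ → Ξ) =>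
      iter F m K γu γv ηu ηv p.1 p.2 u₀ v₀ t := by
  induction t with
  | zero => exact measurable_const
  | succ t ih =>
    have h : Measurable fun q : ((Vec du × (Fin n → Vec dv)) × (Fin n → ℕ → Ξ)) × Finset (Fin n) =>
        roundStep F m K γu γv ηu ηv q.2 q.1.2 q.1.1 :=
      measurable_from_prod_countable_left fun A => measurable_roundStep γu γv hu hv m K ηu ηv A
    exact h.comp ((ih.prodMk ((measurable_pi_apply t).comp measurable_snd)).prodMk
      ((measurable_pi_apply t).comp measurable_fst))

omit [IsProbabilityMeasure P] in
theorem IsSampling.isSample (hs : IsSampling P m D S ξ) (t : ℕ) : IsSample P D (ξ t) where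
  measurable := hs.measurable_ξ t
  law := hs.law_ξ t
  indep := hs.indep_ξ.precomp (g := fun p : Fin n × ℕ => (t, p.1, p.2)) fun p q h => by
    simpa [Prod.ext_iff] using h

/-- The state at time t is a function of the client sets and samples of rounds before t, and these
are independent of `S t` and `ξ t`. -/
theorem IsSampling.indepFun_iter (hs : IsSampling P m D S ξ) (hn : 1 ≤ n)
    (hu : Measurable (fun p : Vec du × Vec dv × Ξ => gradU (fun u v => F u v p.2.2) p.1 p.2.1))
    (hv : Measurable (fun p : Vec du × Vec dv × Ξ => gradV (fun u v => F u v p.2.2) p.1 p.2.1))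
    (t : ℕ) :
    IndepFun (S t) (fun ω => (iter F m K γu γv ηu ηv (fun t => S t ω) (fun t i k => ξ t i k ω)
        u₀ v₀ t, fun i k => ξ t i k ω)) P ∧
      IndepFun (fun ω => iter F m K γu γv ηu ηv (fun t => S t ω) (fun t i k => ξ t i k ω) u₀ v₀ t)
        (fun ω i k => ξ t i k ω) P := by
  obtain ⟨x₀⟩ : Nonempty Ξ := by
    obtain ⟨ω⟩ := P.nonempty_of_neZero
    exact ⟨ξ 0 ⟨0, hn⟩ 0 ω⟩
  -- The past is encoded by full sequences made constant from time t on. By `iter_congr` they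
  -- determine the state at time t, and they are measurable with respect to the past alone.
  set Sp : Ω → ℕ → Finset (Fin n) := fun ω s => if s < t then S s ω else ∅ with hSp
  set ξp : Ω → ℕ → Fin n → ℕ → Ξ := fun ω s i k => if s < t then ξ s i k ω else x₀ with hξp
  set ξt : Ω → Fin n → ℕ → Ξ := fun ω i k => ξ t i k ω with hξt
  have mSp : Measurable Sp := measurable_pi_of_forall fun s => by
    by_cases h : s < t
    · simpa [hSp, h] using hs.measurable_S s
    · simp [hSp, h]
  have mξp : Measurable ξp := measurable_pi_of_forall fun s => measurable_pi_of_forall fun i =>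
    measurable_pi_of_forall fun k => by
      by_cases h : s < t
      · simpa [hξp, h] using hs.measurable_ξ s i k
      · simp [hξp, h]
  have mξt : Measurable ξt := measurable_pi_of_forall fun i => measurable_pi_of_forall fun k =>
    hs.measurable_ξ t i k
  have hSS : IndepFun (S t) Sp P := by
    have h := indep_iSup_of_disjoint (fun s => (hs.measurable_S s).comap_le) hs.indep_S
      (S := {t}) (T := Set.Iio t) (by simp)
    rw [iSup_singleton] at h
    refine indep_of_indep_of_le_right h (Measurable.comap_le ?_)
    refine measurable_pi_of_forall fun s => ?_
    by_cases hst : s < t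
    · simp only [hSp, hst, if_true]
      exact (comap_measurable (S s)).mono (le_iSup₂_of_le s hst le_rfl) le_rfl
    · simp only [hSp, hst, if_false]
      exact measurable_const
  have hξξ : IndepFun ξt ξp P := by
    have h := indep_iSup_of_disjoint
      (fun p : ℕ × Fin n × ℕ => (hs.measurable_ξ p.1 p.2.1 p.2.2).comap_le) hs.indep_ξ
      (S := {p | p.1 = t}) (T := {p | p.1 < t})
      (Set.disjoint_left.2 fun p h1 h2 => (ne_of_lt h2) h1)
    refine indep_of_indep_of_le_left (indep_of_indep_of_le_right h (Measurable.comap_le ?_))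
      (Measurable.comap_le ?_)
    · refine measurable_pi_of_forall fun s => measurable_pi_of_forall fun i =>
        measurable_pi_of_forall fun k => ?_
      by_cases hst : s < t
      · simp only [hξp, hst, if_true]
        exact (comap_measurable (ξ s i k)).mono
          (le_iSup₂_of_le (s, i, k) (by exact hst) le_rfl) le_rfl
      · simp only [hξp, hst, if_false]
        exact measurable_const
    · refine measurable_pi_of_forall fun i => measurable_pi_of_forall fun k => ?_
      exact (comap_measurable (ξ t i k)).mono
        (le_iSup₂_of_le (t, i, k) (by exact rfl) le_rfl) le_rfl
  have hall : IndepFun (fun ω => (S t ω, Sp ω)) (fun ω => (ξt ω, ξp ω)) P := by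
    have hφ : Measurable fun y : ℕ → Finset (Fin n) =>
        (y t, fun s => if s < t then y s else ∅) := by
      refine (measurable_pi_apply t).prodMk (measurable_pi_of_forall fun s => ?_)
      by_cases h : s < t
      · simpa [h] using measurable_pi_apply s
      · simp [h]
    have hψ : Measurable fun y : ℕ × Fin n × ℕ → Ξ => ((fun i k => y (t, i, k),
        fun s i k => if s < t then y (s, i, k) else x₀) :
          (Fin n → ℕ → Ξ) × (ℕ → Fin n → ℕ → Ξ)) := by
      refine Measurable.prodMk (measurable_pi_of_forall fun i => measurable_pi_of_forall fun k =>
        measurable_pi_apply _) (measurable_pi_of_forall fun s => measurable_pi_of_forall fun i =>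
          measurable_pi_of_forall fun k => ?_)
      by_cases h : s < t
      · simpa [h] using measurable_pi_apply (s, i, k)
      · simp [h]
    exact hs.indep_S_ξ.comp hφ hψ
  have hiter : ∀ ω, iter F m K γu γv ηu ηv (fun t => S t ω) (fun t i k => ξ t i k ω) u₀ v₀ t
      = iter F m K γu γv ηu ηv (Sp ω) (ξp ω) u₀ v₀ t := fun ω =>
    iter_congr (fun s h => by simp [hSp, h]) fun s h => by simp [hξp, h]
  have h1 := indepFun_prodMk_of_indepFun (hs.measurable_S t) mSp (mξt.prodMk mξp) hSS hall
  have h2 := indepFun_prodMk_of_indepFun mξt mξp mSp hξξ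
    (hall.symm.comp (φ := id) (ψ := Prod.snd) measurable_id measurable_snd)
  have mi := measurable_iter (F := F) (m := m) (K := K) (γu := γu) (γv := γv) (ηu := ηu)
    (ηv := ηv) (u₀ := u₀) (v₀ := v₀) hu hv t
  simp only [hiter]
  constructor
  · exact h1.comp (φ := id) (ψ := fun p => (iter F m K γu γv ηu ηv p.1 p.2.2 u₀ v₀ t, p.2.1))
      measurable_id ((mi.comp (measurable_fst.prodMk measurable_snd.snd)).prodMk
        measurable_snd.fst)
  · exact (h2.comp (φ := id) (ψ := fun p : (ℕ → Fin n → ℕ → Ξ) × (ℕ → Finset (Fin n)) =>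
      iter F m K γu γv ηu ηv p.2 p.1 u₀ v₀ t)
      measurable_id (mi.comp (measurable_snd.prodMk measurable_fst))).symm

omit [IsProbabilityMeasure P] in
theorem IsSampling.measurable_iter (hs : IsSampling P m D S ξ)
    (hu : Measurable (fun p : Vec du × Vec dv × Ξ => gradU (fun u v => F u v p.2.2) p.1 p.2.1))
    (hv : Measurable (fun p : Vec du × Vec dv × Ξ => gradV (fun u v => F u v p.2.2) p.1 p.2.1))
    (t : ℕ) :
    Measurable fun ω =>
      iter F m K γu γv ηu ηv (fun t => S t ω) (fun t i k => ξ t i k ω) u₀ v₀ t :=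
  (FedAvgP.measurable_iter hu hv t).comp ((measurable_pi_of_forall fun t => hs.measurable_S t).prodMk
    (measurable_pi_of_forall fun t => measurable_pi_of_forall fun i => measurable_pi_of_forall fun k =>
      hs.measurable_ξ t i k))

/-- Sets of another cardinality are null because the `n.choose m` sets of size m already carry total
mass 1. -/
theorem IsSampling.measure_eq (hs : IsSampling P m D S ξ) (hmn : m ≤ n) (t : ℕ)
    (A : Finset (Fin n)) :
    P {ω | S t ω = A} = if A.card = m then ENNReal.ofReal (1 / n.choose m) else 0 := by
  have hC : (n.choose m : ℝ) ≠ 0 := by exact_mod_cast (Nat.choose_pos hmn).ne'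
  have hsum : ∑ A, P.real {ω | S t ω = A} = 1 := by
    have h := Measure.isProbabilityMeasure_map (hs.measurable_S t).aemeasurable (μ := P)
    have h1 := sum_measureReal_singleton (μ := P.map (S t)) Finset.univ
    rw [Finset.coe_univ, probReal_univ] at h1
    rw [← h1]
    refine Finset.sum_congr rfl fun A _ => ?_
    rw [map_measureReal_apply (hs.measurable_S t) (measurableSet_singleton A)]
    rfl
  rw [← ofReal_measureReal]
  split_ifs with hA
  · rw [hs.uniform_S t A hA]
  · rw [← Finset.sum_filter_add_sum_filter_not Finset.univ fun A : Finset (Fin n) => A.card = m,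
      Finset.sum_congr rfl fun A hA => hs.uniform_S t A (Finset.mem_filter.1 hA).2,
      Finset.sum_const, ← Finset.powerset_univ, ← Finset.powersetCard_eq_filter,
      Finset.card_powersetCard, Finset.card_univ, Fintype.card_fin, nsmul_eq_mul,
      mul_one_div_cancel hC, add_eq_left,
      Finset.sum_eq_zero_iff_of_nonneg fun _ _ => measureReal_nonneg] at hsum
    rw [hsum A (by simpa using hA), ENNReal.ofReal_zero]

/-- The law of one round, given the state at its beginning. -/
theorem IsSampling.lintegral_iter_succ (hs : IsSampling P m D S ξ) (hm : 1 ≤ m) (hmn : m ≤ n)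
    (hu : Measurable (fun p : Vec du × Vec dv × Ξ => gradU (fun u v => F u v p.2.2) p.1 p.2.1))
    (hv : Measurable (fun p : Vec du × Vec dv × Ξ => gradV (fun u v => F u v p.2.2) p.1 p.2.1))
    (t : ℕ) {φ : Vec du × (Fin n → Vec dv) → ENNReal} (hφ : Measurable φ) :
    ∫⁻ ω, φ (iter F m K γu γv ηu ηv (fun t => S t ω) (fun t i k => ξ t i k ω) u₀ v₀ (t + 1)) ∂P
      = ∫⁻ ω, ∑ A ∈ Finset.powersetCard m Finset.univ, ENNReal.ofReal (1 / n.choose m) *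
          ∫⁻ ω', φ (roundStep F m K γu γv ηu ηv A (fun i k => ξ t i k ω')
            (iter F m K γu γv ηu ηv (fun t => S t ω) (fun t i k => ξ t i k ω) u₀ v₀ t)) ∂P ∂P := by
  obtain ⟨h1, h2⟩ := hs.indepFun_iter (K := K) (γu := γu) (γv := γv) (ηu := ηu) (ηv := ηv)
    (u₀ := u₀) (v₀ := v₀) (hm.trans hmn) hu hv t
  have mi := hs.measurable_iter (K := K) (γu := γu) (γv := γv) (ηu := ηu) (ηv := ηv)
    (u₀ := u₀) (v₀ := v₀) hu hv t
  have mξ : Measurable fun ω (i : Fin n) (k : ℕ) => ξ t i k ω :=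
    measurable_pi_of_forall fun i => measurable_pi_of_forall fun k => hs.measurable_ξ t i k
  have mr := fun A => hφ.comp (measurable_roundStep γu γv hu hv m K ηu ηv A)
  simp only [iter_succ]
  rw [lintegral_comp_finset_of_indepFun (hs.measurable_S t) (mi.prodMk mξ) h1
    (φ := fun A y => φ (roundStep F m K γu γv ηu ηv A y.2 y.1)) mr]
  have h3 : ∀ A, ∫⁻ ω, φ (roundStep F m K γu γv ηu ηv A (fun i k => ξ t i k ω)
      (iter F m K γu γv ηu ηv (fun t => S t ω) (fun t i k => ξ t i k ω) u₀ v₀ t)) ∂P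
      = ∫⁻ ω, ∫⁻ ω', φ (roundStep F m K γu γv ηu ηv A (fun i k => ξ t i k ω')
          (iter F m K γu γv ηu ηv (fun t => S t ω) (fun t i k => ξ t i k ω) u₀ v₀ t)) ∂P ∂P :=
    fun A => lintegral_comp_of_indepFun mi mξ h2 (mr A)
  simp only [h3, hs.measure_eq hmn, ite_mul, zero_mul]
  have mA : ∀ A, Measurable fun ω => ∫⁻ ω', φ (roundStep F m K γu γv ηu ηv A
      (fun i k => ξ t i k ω')
      (iter F m K γu γv ηu ηv (fun t => S t ω) (fun t i k => ξ t i k ω) u₀ v₀ t)) ∂P := fun A =>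
    Measurable.lintegral_prod_right' (f := fun p : Ω × Ω =>
      φ (roundStep F m K γu γv ηu ηv A (fun i k => ξ t i k p.2)
      (iter F m K γu γv ηu ηv (fun t => S t p.1) (fun t i k => ξ t i k p.1) u₀ v₀ t)))
      ((mr A).comp ((mi.comp measurable_fst).prodMk (mξ.comp measurable_snd)))
  rw [← Finset.sum_filter, ← Finset.powerset_univ, ← Finset.powersetCard_eq_filter,
    lintegral_finsetSum _ fun A _ => (mA A).const_mul _]
  exact Finset.sum_congr rfl fun A _ => (lintegral_const_mul _ (mA A)).symm

end Rounds

/-! ### Convergence -/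

section Convergence

variable {du dv n : ℕ} {Ξ Ω : Type*} [MeasurableSpace Ξ] [MeasurableSpace Ω]
  {P : Measure Ω} [IsProbabilityMeasure P] {D : Fin n → Measure Ξ} [∀ i, IsProbabilityMeasure (D i)]
  {F : Vec du → Vec dv → Ξ → ℝ} {Lu Lv Luv Lvu : ℝ≥0} {L σu σv : ℝ} {x : Fin n → ℕ → Ω → Ξ}

/-- The variance term of the convergence rate. -/
noncomputable def varianceTerm (n m K : ℕ) (b σu σv : ℝ) : ℝ :=
  4 * ((n : ℝ) - m) * K * b ^ 2 / (m * n) + σu ^ 2 / m + m * σv ^ 2 / n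

/-- Descent from a fixed state, in a form free of subtraction: the gradient term stands on the left
and the objective is shifted by a lower bound `c`. -/
theorem RoundAssumptions.sum_lintegral_roundStep_le
    (hR : RoundAssumptions F D Lu Lv Luv Lvu L σu σv P x) {b γ Y γu γv ηu ηv : ℝ} {m K : ℕ}
    (hm : 1 ≤ m) (hmn : m ≤ n) (hK : 1 ≤ K) (hb : BoundedDissimilarity F D b) (hγ : 0 ≤ γ)
    (h32 : 32 * (γ * L * K) ≤ 1) (hY : 0 ≤ Y) (hγuη : γu * ηu = γ) (hγvη : γv * ηv = γ)
    (hγu : γu ^ 2 * m ≤ γ ^ 2)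
    (hγub : γu ^ 2 * b ^ 2 ≤ γ ^ 2 * Y) (hγv : γv ^ 2 ≤ γ ^ 2 * (m / n)) {c : ℝ}
    (hc : ∀ u v, c ≤ globalObj F D u v) (s : Vec du × (Fin n → Vec dv)) :
    (∑ A ∈ Finset.powersetCard m Finset.univ, ENNReal.ofReal (1 / n.choose m) *
        ∫⁻ ω, ENNReal.ofReal
          (globalObj F D (roundStep F m K γu γv ηu ηv A (fun i k => x i k ω) s).1
            (roundStep F m K γu γv ηu ηv A (fun i k => x i k ω) s).2 - c) ∂P)
        + ENNReal.ofReal (γ * K / 4 * gradSq F D m s)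
      ≤ ENNReal.ofReal (globalObj F D s.1 s.2 - c)
        + ENNReal.ofReal (3 * L * K * γ ^ 2 * varianceTerm n m K b σu σv + γ * K * Y / 4) := by
  obtain ⟨u, v⟩ := s
  have hC : (0 : ℝ) < n.choose m := by exact_mod_cast Nat.choose_pos hmn
  set I : Finset (Fin n) → ℝ := fun A => ∫ ω,
    (globalObj F D (roundStep F m K γu γv ηu ηv A (fun i k => x i k ω) (u, v)).1
      (roundStep F m K γu γv ηu ηv A (fun i k => x i k ω) (u, v)).2 - c) ∂P with hI
  have hI0 : ∀ A, 0 ≤ I A := fun A => integral_nonneg fun ω => sub_nonneg.2 (hc _ _)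
  have hA : ∀ A ∈ Finset.powersetCard m (Finset.univ : Finset (Fin n)),
      ∫⁻ ω, ENNReal.ofReal
          (globalObj F D (roundStep F m K γu γv ηu ηv A (fun i k => x i k ω) (u, v)).1
            (roundStep F m K γu γv ηu ηv A (fun i k => x i k ω) (u, v)).2 - c) ∂P
        = ENNReal.ofReal (I A) ∧
      I A ≤ globalObj F D u v - c + roundBound γu γv u v F D P x L σu σv γ K A := by
    intro A hA
    obtain ⟨h1, h2⟩ := hR.integral_globalObj_roundStep_le γu γv u v hm hK hγ hγuη hγvη
      (Finset.mem_powersetCard.1 hA).2 hc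
    refine ⟨(ofReal_integral_eq_lintegral_ofReal (h1.sub (integrable_const c))
      (Filter.Eventually.of_forall fun ω => sub_nonneg.2 (hc _ _))).symm, ?_⟩
    simp only [hI]
    rw [integral_sub h1 (integrable_const c), integral_const, probReal_univ, one_smul]
    linarith
  have hgs : 0 ≤ gradSq F D m (u, v) := add_nonneg (sq_nonneg _)
    (mul_nonneg (by positivity) (Finset.sum_nonneg fun i _ => sq_nonneg _))
  rw [Finset.sum_congr rfl fun A h => by rw [(hA A h).1, ← ENNReal.ofReal_mul (by positivity)],
    ← ENNReal.ofReal_sum_of_nonneg fun A _ => mul_nonneg (by positivity) (hI0 A),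
    ← ENNReal.ofReal_add (Finset.sum_nonneg fun A _ => mul_nonneg (by positivity) (hI0 A))
      (by positivity)]
  refine le_trans (ENNReal.ofReal_le_ofReal ?_) ENNReal.ofReal_add_le
  have h1 := hR.sum_roundBound_le γu γv u v hm hmn hb hγ h32 hY hγu hγub hγv
  have h2 : ∑ A ∈ Finset.powersetCard m (Finset.univ : Finset (Fin n)), I A
      ≤ n.choose m * (globalObj F D u v - c)
        + ∑ A ∈ Finset.powersetCard m Finset.univ,
          roundBound γu γv u v F D P x L σu σv γ K A := by
    refine (Finset.sum_le_sum fun A h => (hA A h).2).trans_eq ?_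
    rw [Finset.sum_add_distrib, Finset.sum_const, Finset.card_powersetCard, Finset.card_univ,
      Fintype.card_fin, nsmul_eq_mul]
  have h3 : ∑ A ∈ Finset.powersetCard m (Finset.univ : Finset (Fin n)), I A
      ≤ n.choose m * (globalObj F D u v - c + (-(γ * K / 4) * gradSq F D m (u, v)
        + 3 * L * K * γ ^ 2 * varianceTerm n m K b σu σv + γ * K * Y / 4)) := by
    refine (h2.trans (add_le_add le_rfl h1)).trans_eq ?_
    rw [varianceTerm]
    ring
  rw [← Finset.mul_sum, one_div]
  have h4 := (inv_mul_le_iff₀ hC).2 h3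
  linarith

omit [∀ i, IsProbabilityMeasure (D i)] in
theorem Smoothness.continuous_globalGradU (hs : Smoothness F D Lu Lv Luv Lvu) :
    Continuous fun s : Vec du × (Fin n → Vec dv) => globalGradU F D s.1 s.2 := by
  simp only [hs.globalGradU_eq]
  have h : ∀ i, Continuous fun s : Vec du × (Fin n → Vec dv) => (s.1, s.2 i) :=
    fun i => continuous_fst.prodMk ((continuous_apply i).comp continuous_snd)
  exact (continuous_finsetSum _ fun i _ => (hs.continuous_gradU i).comp (h i)).const_smul (1 / (n : ℝ))

omit [∀ i, IsProbabilityMeasure (D i)] in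
theorem Smoothness.continuous_gradV_apply (hs : Smoothness F D Lu Lv Luv Lvu) (i : Fin n) :
    Continuous fun s : Vec du × (Fin n → Vec dv) => gradV (localObj F (D i)) s.1 (s.2 i) :=
  (hs.continuous_gradV i).comp
    (continuous_fst.prodMk ((continuous_apply i).comp continuous_snd))

omit [∀ i, IsProbabilityMeasure (D i)] in
theorem Smoothness.measurable_gradSq (hs : Smoothness F D Lu Lv Luv Lvu) (m : ℕ) :
    Measurable (gradSq F D m) :=
  ((hs.continuous_globalGradU.norm.pow 2).add (continuous_const.mul
    (continuous_finsetSum _ fun i _ => (hs.continuous_gradV_apply i).norm.pow 2))).measurable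

omit [∀ i, IsProbabilityMeasure (D i)] in
/-- The smoothness constant of an objective that is bounded below and not minimal at the initial
point is positive. -/
theorem Smoothness.pos_of_initialGap_pos (hs : Smoothness F D Lu Lv Luv Lvu) (hn : 1 ≤ n)
    (hLu : (Lu : ℝ) ≤ L) (hLv : (Lv : ℝ) ≤ L) (hLuv : (Luv : ℝ) ≤ L)
    {u₀ : Vec du} {v₀ : Fin n → Vec dv} {c : ℝ} (hc : ∀ u v, c ≤ globalObj F D u v)
    (hpos : 0 < initialGap F D u₀ v₀) : 0 < L := by
  refine lt_of_le_of_ne (Lu.coe_nonneg.trans hLu) fun h0 => hpos.not_ge ?_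
  have hn' : (0 : ℝ) < n := by exact_mod_cast hn
  have hle := hs.globalObj_le hn hLu hLv hLuv
  simp only [← h0, zero_mul, add_zero] at hle
  have hzero : ∀ u v, globalGradU F D u v = 0 ∧ ∀ i, gradV (localObj F (D i)) u (v i) = 0 := by
    intro u v
    set q := ‖globalGradU F D u v‖ ^ 2
      + 1 / (n : ℝ) * ∑ i, ‖gradV (localObj F (D i)) u (v i)‖ ^ 2 with hq
    have hs0 : 0 ≤ 1 / (n : ℝ) * ∑ i, ‖gradV (localObj F (D i)) u (v i)‖ ^ 2 :=
      mul_nonneg (by positivity) (Finset.sum_nonneg fun i _ => sq_nonneg _)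
    have hq0 : 0 ≤ q := add_nonneg (sq_nonneg _) hs0
    -- With L = 0 the upper bound has no quadratic term, so a gradient step of arbitrary length r
    -- decreases the objective by at least r q; boundedness below forces q = 0.
    have hdec : ∀ r : ℝ, c ≤ globalObj F D u v - r * q := by
      intro r
      refine (hc _ _).trans ((hle u (u - r • globalGradU F D u v) v
        fun i => v i - r • gradV (localObj F (D i)) u (v i)).trans_eq ?_)
      simp only [sub_sub_cancel_left, inner_neg_right, real_inner_smul_right,
        real_inner_self_eq_norm_sq, Finset.sum_neg_distrib, ← Finset.mul_sum, hq]
      ring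
    have hq1 : q = 0 := by
      by_contra hne
      have := hdec ((globalObj F D u v - c + 1) / q)
      rw [div_mul_cancel₀ _ hne] at this
      linarith
    have hA : ‖globalGradU F D u v‖ ^ 2 = 0 := le_antisymm (by linarith) (sq_nonneg _)
    have hB : ∑ i, ‖gradV (localObj F (D i)) u (v i)‖ ^ 2 = 0 := by
      have : 1 / (n : ℝ) * ∑ i, ‖gradV (localObj F (D i)) u (v i)‖ ^ 2 = 0 := by linarith
      exact (mul_eq_zero.1 this).resolve_left (by positivity)
    refine ⟨by simpa using hA, fun i => ?_⟩
    have := (Finset.sum_eq_zero_iff_of_nonneg fun i _ => sq_nonneg _).1 hB i (Finset.mem_univ i)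
    simpa using this
  -- All gradients vanish, so the linear upper bound taken at (u, v) shows that the initial point is
  -- a minimizer.
  have hmin : ∀ u v, globalObj F D u₀ v₀ ≤ globalObj F D u v := by
    intro u v
    have := hle u u₀ v v₀
    simpa [(hzero u v).1, (hzero u v).2] using this
  exact sub_nonpos.2 (le_ciInf fun p => hmin p.1 p.2)

/-- Sums of a nonnegative sequence controlled by a potential. -/
theorem sum_le_of_add_le {a y : ℕ → ENNReal} {e : ENNReal} (h : ∀ t, a (t + 1) + y t ≤ a t + e)
    (T : ℕ) : ∑ t ∈ Finset.range T, y t ≤ a 0 + T * e := by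
  have : a T + ∑ t ∈ Finset.range T, y t ≤ a 0 + T * e := by
    induction T with
    | zero => simp
    | succ T ih =>
      calc a (T + 1) + ∑ t ∈ Finset.range (T + 1), y t
          = (a (T + 1) + y T) + ∑ t ∈ Finset.range T, y t := by
            rw [Finset.sum_range_succ]
            ring
        _ ≤ (a T + ∑ t ∈ Finset.range T, y t) + e := by
            refine (add_le_add (h T) le_rfl).trans_eq ?_
            ring
        _ ≤ a 0 + (T + 1 : ℕ) * e := by
            refine (add_le_add ih le_rfl).trans_eq ?_
            push_cast
            ring
  exact le_add_self.trans this

variable {m K : ℕ} {γu γv ηu ηv : ℝ} {u₀ : Vec du} {v₀ : Fin n → Vec dv}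
  {S : ℕ → Ω → Finset (Fin n)} {ξ : ℕ → Fin n → ℕ → Ω → Ξ}

/-- The descent inequality is averaged over the state at time t and telescoped. Only the initial
potential has to be finite. -/
theorem sum_integral_gradSq_le (hs : Smoothness F D Lu Lv Luv Lvu)
    (hg : StochasticGradient F D σu σv) (hLu : (Lu : ℝ) ≤ L) (hLv : (Lv : ℝ) ≤ L)
    (hLuv : (Luv : ℝ) ≤ L) (hLvu : (Lvu : ℝ) ≤ L) (hsamp : IsSampling P m D S ξ) {b γ Y : ℝ}
    (hm : 1 ≤ m) (hmn : m ≤ n) (hK : 1 ≤ K) (hb : BoundedDissimilarity F D b) (hγ : 0 < γ)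
    (h32 : 32 * (γ * L * K) ≤ 1) (hY : 0 ≤ Y) (hγuη : γu * ηu = γ) (hγvη : γv * ηv = γ)
    (hγu : γu ^ 2 * m ≤ γ ^ 2)
    (hγub : γu ^ 2 * b ^ 2 ≤ γ ^ 2 * Y) (hγv : γv ^ 2 ≤ γ ^ 2 * (m / n)) {c : ℝ}
    (hc : ∀ u v, c ≤ globalObj F D u v) (hV : 0 ≤ varianceTerm n m K b σu σv) (T : ℕ) :
    (∀ t < T, Integrable (fun ω => gradSq F D m
      (iter F m K γu γv ηu ηv (fun t => S t ω) (fun t i k => ξ t i k ω) u₀ v₀ t)) P) ∧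
    γ * K / 4 * ∑ t ∈ Finset.range T, ∫ ω, gradSq F D m
      (iter F m K γu γv ηu ηv (fun t => S t ω) (fun t i k => ξ t i k ω) u₀ v₀ t) ∂P
      ≤ globalObj F D u₀ v₀ - c
        + T * (3 * L * K * γ ^ 2 * varianceTerm n m K b σu σv + γ * K * Y / 4) := by
  set st : ℕ → Ω → Vec du × (Fin n → Vec dv) := fun t ω =>
    iter F m K γu γv ηu ηv (fun t => S t ω) (fun t i k => ξ t i k ω) u₀ v₀ t with hst
  set e := 3 * L * K * γ ^ 2 * varianceTerm n m K b σu σv + γ * K * Y / 4 with he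
  have hL : 0 ≤ L := Lu.coe_nonneg.trans hLu
  have he0 : 0 ≤ e := by positivity
  have hK' : (0 : ℝ) < K := by exact_mod_cast hK
  have hgs : ∀ s, 0 ≤ gradSq F D m s := fun s => add_nonneg (sq_nonneg _)
    (mul_nonneg (by positivity) (Finset.sum_nonneg fun i _ => sq_nonneg _))
  have mst : ∀ t, Measurable (st t) := fun t => hsamp.measurable_iter hg.measurable_u
    hg.measurable_v t
  have mφ : Measurable fun s : Vec du × (Fin n → Vec dv) =>
      ENNReal.ofReal (globalObj F D s.1 s.2 - c) :=
    (hs.measurable_globalObj.sub_const c).ennreal_ofReal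
  have mgs : ∀ t, Measurable fun ω => γ * K / 4 * gradSq F D m (st t ω) := fun t =>
    ((hs.measurable_gradSq m).comp (mst t)).const_mul _
  have hstep : ∀ t, ∫⁻ ω, ENNReal.ofReal (globalObj F D (st (t + 1) ω).1 (st (t + 1) ω).2 - c) ∂P
      + ∫⁻ ω, ENNReal.ofReal (γ * K / 4 * gradSq F D m (st t ω)) ∂P
      ≤ ∫⁻ ω, ENNReal.ofReal (globalObj F D (st t ω).1 (st t ω).2 - c) ∂P + ENNReal.ofReal e := by
    intro t
    have hR : RoundAssumptions F D Lu Lv Luv Lvu L σu σv P (ξ t) :=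
      ⟨hs, hLu, hLv, hLuv, hLvu, hg, hsamp.isSample t⟩
    have h1 := hsamp.lintegral_iter_succ (K := K) (γu := γu) (γv := γv) (ηu := ηu) (ηv := ηv)
      (u₀ := u₀) (v₀ := v₀) hm hmn hg.measurable_u hg.measurable_v t mφ
    have h2 : ENNReal.ofReal e = ∫⁻ _, ENNReal.ofReal e ∂P := by simp
    rw [h1, h2, ← lintegral_add_right _ (mgs t).ennreal_ofReal,
      ← lintegral_add_right _ measurable_const]
    exact lintegral_mono fun ω => hR.sum_lintegral_roundStep_le hm hmn hK hb hγ.le h32 hY hγuη hγvη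
      hγu hγub hγv hc (st t ω)
  have hsum := sum_le_of_add_le hstep T
  have h0 : ∫⁻ ω, ENNReal.ofReal (globalObj F D (st 0 ω).1 (st 0 ω).2 - c) ∂P
      = ENNReal.ofReal (globalObj F D u₀ v₀ - c) := by
    have : ∀ ω, st 0 ω = (u₀, v₀) := fun ω => rfl
    simp [this]
  have hc0 : 0 ≤ globalObj F D u₀ v₀ - c := sub_nonneg.2 (hc _ _)
  rw [h0, ← ENNReal.ofReal_natCast, ← ENNReal.ofReal_mul (by positivity),
    ← ENNReal.ofReal_add hc0 (by positivity)] at hsum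
  -- Each summand is at most the whole sum, which has just been bounded by a finite quantity.
  have hint : ∀ t < T, Integrable (fun ω => γ * K / 4 * gradSq F D m (st t ω)) P := by
    intro t ht
    refine ⟨(mgs t).aestronglyMeasurable, ?_⟩
    rw [hasFiniteIntegral_iff_ofReal
      (Filter.Eventually.of_forall fun ω => mul_nonneg (by positivity) (hgs _))]
    exact ((Finset.single_le_sum (f := fun t => ∫⁻ ω, ENNReal.ofReal
      (γ * K / 4 * gradSq F D m (st t ω)) ∂P) (fun _ _ => zero_le) (Finset.mem_range.2 ht)).trans
        hsum).trans_lt ENNReal.ofReal_lt_top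
  refine ⟨fun t ht => ?_, ?_⟩
  · have := (hint t ht).const_mul (γ * K / 4)⁻¹
    refine this.congr (Filter.Eventually.of_forall fun ω => ?_)
    exact inv_mul_cancel_left₀ (by positivity) _
  · rw [Finset.mul_sum]
    simp only [← integral_const_mul]
    have h3 : ∀ t ∈ Finset.range T, ∫⁻ ω, ENNReal.ofReal (γ * K / 4 * gradSq F D m (st t ω)) ∂P
        = ENNReal.ofReal (∫ ω, γ * K / 4 * gradSq F D m (st t ω) ∂P) := fun t ht =>
      (ofReal_integral_eq_lintegral_ofReal (hint t (Finset.mem_range.1 ht))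
        (Filter.Eventually.of_forall fun ω => mul_nonneg (by positivity) (hgs _))).symm
    rw [Finset.sum_congr rfl h3, ← ENNReal.ofReal_sum_of_nonneg fun t _ =>
      integral_nonneg fun ω => mul_nonneg (by positivity) (hgs _)] at hsum
    exact (ENNReal.ofReal_le_ofReal_iff (by positivity)).1 hsum

/-- The convergence rate for the prescribed step size. -/
theorem rate_le {L K T F₀ A γ M : ℝ} (hL : 0 < L) (hK : 0 < K) (hT : 0 < T) (hF₀ : 0 < F₀)
    (hA : 0 ≤ A) (hγ : γ = (32 * L * K + √(3 * L * K * T / F₀ * A))⁻¹)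
    (hM : γ * K / 4 * M ≤ F₀ + T * (3 * L * K * γ ^ 2 * A + γ * K * (L * F₀ / T) / 4)) :
    1 / T * M ≤ 8 * √(3 * A * (L * F₀ / (K * T))) + 129 * L * F₀ / T := by
  set R := √(3 * L * K * T / F₀ * A) with hR
  set Q := √(3 * A * (L * F₀ / (K * T))) with hQ
  have hR0 : 0 ≤ R := Real.sqrt_nonneg _
  have hQ0 : 0 ≤ Q := Real.sqrt_nonneg _
  have hden : 0 < 32 * L * K + R := by positivity
  have hγ0 : 0 < γ := hγ ▸ inv_pos.2 hden
  have hγ1 : γ * (32 * L * K + R) = 1 := by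
    rw [hγ]
    exact inv_mul_cancel₀ hden.ne'
  -- R is the square root inside γ⁻¹ and Q the one in the rate. They are proportional, F₀R = KTQ,
  -- and their product is 3LA; with γR ≤ 1 the variance cost 3LγA is at most Q.
  have hRQ : R * Q = 3 * L * A := by
    rw [hR, hQ, ← Real.sqrt_mul (by positivity), Real.sqrt_eq_iff_mul_self_eq (by positivity)
      (by positivity)]
    field_simp
  have hFR : F₀ * R = K * T * Q := by
    rw [hR, hQ, ← Real.sqrt_sq hF₀.le, ← Real.sqrt_sq (by positivity : 0 ≤ K * T),
      ← Real.sqrt_mul (by positivity), ← Real.sqrt_mul (by positivity), Real.sqrt_sq hF₀.le,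
      Real.sqrt_sq (by positivity : 0 ≤ K * T)]
    congr 1
    field_simp
  have hγR : γ * R ≤ 1 := by
    have : 0 ≤ γ * (32 * L * K) := by positivity
    linarith
  have h1 : γ * (3 * L * A) ≤ Q := by
    rw [← hRQ, ← mul_assoc]
    exact mul_le_of_le_one_left hQ0 hγR
  have h2 : F₀ = γ * (32 * L * K * F₀ + K * T * Q) := by
    rw [← hFR]
    linear_combination (-F₀) * hγ1
  -- The three contributions are the initial gap (128LF₀ + 4TQ, by `h2`), the variance (4TQ) and the
  -- dissimilarity allowance (LF₀), hence the constants 8 and 129.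
  have h3 : γ * K / 4 * M ≤ γ * K / 4 * (4 * (32 * L * F₀ + T * Q) + 4 * T * Q + L * F₀) := by
    have h4 : T * (3 * L * K * γ ^ 2 * A) ≤ T * γ * K * Q := by
      have := mul_le_mul_of_nonneg_left h1 (by positivity : 0 ≤ T * γ * K)
      linarith
    have h5 : T * (γ * K * (L * F₀ / T) / 4) = γ * K * (L * F₀) / 4 := by field_simp
    linarith
  have h6 := le_of_mul_le_mul_left h3 (by positivity)
  rw [one_div, inv_mul_le_iff₀ hT, mul_add, mul_div_cancel₀ _ hT.ne']
  linarith

end Convergence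

end FedAvgP

/-! ### The convergence rate of FedAvg-P -/

theorem mainTheorem2
    {du dv n : ℕ} {Ξ Ω : Type*} [MeasurableSpace Ξ] [MeasurableSpace Ω]
    (P : Measure Ω) [IsProbabilityMeasure P]
    (F : FedAvgP.Vec du → FedAvgP.Vec dv → Ξ → ℝ)
    (D : Fin n → Measure Ξ) [∀ i, IsProbabilityMeasure (D i)]
    (m K T : ℕ) (hm : 1 ≤ m) (hmn : m ≤ n) (hK : 1 ≤ K) (hT : 1 ≤ T)
    (Lu Lv Luv Lvu : ℝ≥0) (L b σu σv : ℝ)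
    (hL : L = max (max (Lu : ℝ) (Lv : ℝ)) (max (Luv : ℝ) (Lvu : ℝ)))
    (hsmooth : FedAvgP.Smoothness F D Lu Lv Luv Lvu)
    (hsto : FedAvgP.StochasticGradient F D σu σv)
    (hb : 0 < b) (hbgd : FedAvgP.BoundedDissimilarity F D b)
    (u₀ : FedAvgP.Vec du) (v₀ : Fin n → FedAvgP.Vec dv) (F₀ : ℝ)
    (hbdd : BddBelow (Set.range
      fun p : FedAvgP.Vec du × (Fin n → FedAvgP.Vec dv) => FedAvgP.globalObj F D p.1 p.2))
    (hF₀ : F₀ = FedAvgP.initialGap F D u₀ v₀) (hF₀_pos : 0 < F₀)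
    (γ γu γv ηu ηv : ℝ)
    (hγ : γ = (32 * L * K + √(3 * L * K * T / F₀ *
      (4 * ((n : ℝ) - m) * K * b ^ 2 / (m * n) + σu ^ 2 / m + m * σv ^ 2 / n)))⁻¹)
    (hγu : γu * ηu = γ) (hγv : γv * ηv = γ)
    (hηv : √((n : ℝ) / m) ≤ ηv)
    (hηu : max (√(m : ℝ)) (√(b ^ 2 * T / (L * F₀))) ≤ ηu)
    (S : ℕ → Ω → Finset (Fin n)) (ξ : ℕ → Fin n → ℕ → Ω → Ξ)
    (hsampling : FedAvgP.IsSampling P m D S ξ)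
    (u : ℕ → Ω → FedAvgP.Vec du) (v : ℕ → Ω → Fin n → FedAvgP.Vec dv)
    (hiter : ∀ t ω, (u t ω, v t ω) = FedAvgP.iter F m K γu γv ηu ηv
      (fun t => S t ω) (fun t i k => ξ t i k ω) u₀ v₀ t) :
    (∀ t < T, Integrable (fun ω => ‖FedAvgP.globalGradU F D (u t ω) (v t ω)‖ ^ 2) P) ∧
    (∀ t < T, ∀ i, Integrable (fun ω =>
      ‖FedAvgP.gradV (FedAvgP.localObj F (D i)) (u t ω) (v t ω i)‖ ^ 2) P) ∧
    (1 / (T : ℝ)) * ∑ t ∈ Finset.range T,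
        ((∫ ω, ‖FedAvgP.globalGradU F D (u t ω) (v t ω)‖ ^ 2 ∂P) +
          (m : ℝ) / (n : ℝ) ^ 2 * ∑ i, ∫ ω,
            ‖FedAvgP.gradV (FedAvgP.localObj F (D i)) (u t ω) (v t ω i)‖ ^ 2 ∂P)
      ≤ 8 * √(3 * (4 * ((n : ℝ) - m) * K * b ^ 2 / (m * n) + σu ^ 2 / m + m * σv ^ 2 / n) *
            (L * F₀ / (K * T)))
          + 129 * L * F₀ / T := by
  have hLu : (Lu : ℝ) ≤ L := hL ▸ (le_max_left _ _).trans (le_max_left _ _)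
  have hLv : (Lv : ℝ) ≤ L := hL ▸ (le_max_right _ _).trans (le_max_left _ _)
  have hLuv : (Luv : ℝ) ≤ L := hL ▸ (le_max_left _ _).trans (le_max_right _ _)
  have hLvu : (Lvu : ℝ) ≤ L := hL ▸ (le_max_right _ _).trans (le_max_right _ _)
  have hm0 : (0 : ℝ) < m := by exact_mod_cast hm
  have hmn' : (m : ℝ) ≤ n := by exact_mod_cast hmn
  have hn0 : (0 : ℝ) < n := hm0.trans_le hmn'
  have hK0 : (0 : ℝ) < K := by exact_mod_cast hK
  have hT0 : (0 : ℝ) < T := by exact_mod_cast hT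
  have hc : ∀ u v, (⨅ p : FedAvgP.Vec du × (Fin n → FedAvgP.Vec dv),
      FedAvgP.globalObj F D p.1 p.2) ≤ FedAvgP.globalObj F D u v :=
    fun u v => ciInf_le hbdd (u, v)
  -- Strict positivity is needed for γ > 0 and for the division by L F₀ in the condition on ηu.
  have hL0 : 0 < L := hsmooth.pos_of_initialGap_pos (hm.trans hmn) hLu hLv hLuv hc (hF₀ ▸ hF₀_pos)
  have hV : 0 ≤ FedAvgP.varianceTerm n m K b σu σv := by
    have : (0 : ℝ) ≤ n - m := sub_nonneg.2 hmn'
    rw [FedAvgP.varianceTerm]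
    positivity
  change γ = (32 * L * K + √(3 * L * K * T / F₀ * FedAvgP.varianceTerm n m K b σu σv))⁻¹ at hγ
  have hden : 0 < 32 * L * K + √(3 * L * K * T / F₀ * FedAvgP.varianceTerm n m K b σu σv) := by
    positivity
  have hγ0 : 0 < γ := hγ ▸ inv_pos.2 hden
  have h32 : 32 * (γ * L * K) ≤ 1 := by
    have h1 : γ * (32 * L * K + √(3 * L * K * T / F₀ * FedAvgP.varianceTerm n m K b σu σv)) = 1 := by
      rw [hγ]
      exact inv_mul_cancel₀ hden.ne'
    have h2 := mul_nonneg hγ0.le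
      (Real.sqrt_nonneg (3 * L * K * T / F₀ * FedAvgP.varianceTerm n m K b σu σv))
    linarith
  have hηu1 : (m : ℝ) ≤ ηu ^ 2 := (Real.sqrt_le_iff.1 ((le_max_left _ _).trans hηu)).2
  have hηu2 : b ^ 2 * T / (L * F₀) ≤ ηu ^ 2 := (Real.sqrt_le_iff.1 ((le_max_right _ _).trans hηu)).2
  have hηv1 : (n : ℝ) / m ≤ ηv ^ 2 := (Real.sqrt_le_iff.1 hηv).2
  have hγu2 : γ ^ 2 = γu ^ 2 * ηu ^ 2 := by rw [← hγu, mul_pow]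
  have hγv2 : γ ^ 2 = γv ^ 2 * ηv ^ 2 := by rw [← hγv, mul_pow]
  have hu1 : γu ^ 2 * m ≤ γ ^ 2 := hγu2 ▸ mul_le_mul_of_nonneg_left hηu1 (sq_nonneg _)
  -- The allowance Y is taken to be L F₀ / T, so that its total cost over T rounds does not depend
  -- on T apart from γ.
  have hu2 : γu ^ 2 * b ^ 2 ≤ γ ^ 2 * (L * F₀ / T) := by
    have h := mul_le_mul_of_nonneg_right (mul_le_mul_of_nonneg_left hηu2 (sq_nonneg γu))
      (by positivity : 0 ≤ L * F₀ / T)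
    rw [← hγu2] at h
    refine le_trans (le_of_eq ?_) h
    field_simp
  have hv1 : γv ^ 2 ≤ γ ^ 2 * (m / n) := by
    have h := mul_le_mul_of_nonneg_right (mul_le_mul_of_nonneg_left hηv1 (sq_nonneg γv))
      (by positivity : 0 ≤ (m : ℝ) / n)
    rw [← hγv2] at h
    refine le_trans (le_of_eq ?_) h
    field_simp
  obtain ⟨hint, hsum⟩ := FedAvgP.sum_integral_gradSq_le (u₀ := u₀) (v₀ := v₀) hsmooth hsto hLu hLv
    hLuv hLvu hsampling hm hmn hK hbgd hγ0 h32 (by positivity : 0 ≤ L * F₀ / T) hγu hγv hu1 hu2 hv1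
    hc hV T
  simp only [← hiter] at hint hsum
  have mst : ∀ t, Measurable fun ω => (u t ω, v t ω) := fun t => by
    simp only [hiter]
    exact hsampling.measurable_iter hsto.measurable_u hsto.measurable_v t
  have hV0 : ∀ t ω, 0 ≤ (m : ℝ) / (n : ℝ) ^ 2 *
      ∑ i, ‖FedAvgP.gradV (FedAvgP.localObj F (D i)) (u t ω) (v t ω i)‖ ^ 2 := fun t ω =>
    mul_nonneg (by positivity) (Finset.sum_nonneg fun i _ => sq_nonneg _)
  have hU : ∀ t < T, Integrable (fun ω => ‖FedAvgP.globalGradU F D (u t ω) (v t ω)‖ ^ 2) P := by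
    intro t ht
    refine (hint t ht).mono' ((hsmooth.continuous_globalGradU.norm.pow 2).measurable.comp
      (mst t)).aestronglyMeasurable (Filter.Eventually.of_forall fun ω => ?_)
    rw [Real.norm_of_nonneg (sq_nonneg _)]
    exact le_add_of_nonneg_right (hV0 t ω)
  have hVi : ∀ t < T, ∀ i, Integrable (fun ω =>
      ‖FedAvgP.gradV (FedAvgP.localObj F (D i)) (u t ω) (v t ω i)‖ ^ 2) P := by
    intro t ht i
    refine ((hint t ht).const_mul ((n : ℝ) ^ 2 / m)).mono'
      (((hsmooth.continuous_gradV_apply i).norm.pow 2).measurable.comp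
      (mst t)).aestronglyMeasurable (Filter.Eventually.of_forall fun ω => ?_)
    rw [Real.norm_of_nonneg (sq_nonneg _)]
    have h1 := Finset.single_le_sum (f := fun i =>
      ‖FedAvgP.gradV (FedAvgP.localObj F (D i)) (u t ω) (v t ω i)‖ ^ 2)
      (fun i _ => sq_nonneg _) (Finset.mem_univ i)
    -- Rescaling by n²/m makes the sum of the v-gradients appear with coefficient 1, so `gradSq`
    -- dominates each of its terms.
    have h2 : (n : ℝ) ^ 2 / m * FedAvgP.gradSq F D m (u t ω, v t ω)
        = (n : ℝ) ^ 2 / m * ‖FedAvgP.globalGradU F D (u t ω) (v t ω)‖ ^ 2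
          + ∑ i, ‖FedAvgP.gradV (FedAvgP.localObj F (D i)) (u t ω) (v t ω i)‖ ^ 2 := by
      rw [FedAvgP.gradSq]
      field_simp
    rw [h2]
    exact h1.trans (le_add_of_nonneg_left (mul_nonneg (by positivity) (sq_nonneg _)))
  refine ⟨hU, hVi, ?_⟩
  have hsplit : ∀ t ∈ Finset.range T,
      (∫ ω, ‖FedAvgP.globalGradU F D (u t ω) (v t ω)‖ ^ 2 ∂P) + (m : ℝ) / (n : ℝ) ^ 2 * ∑ i, ∫ ω,
        ‖FedAvgP.gradV (FedAvgP.localObj F (D i)) (u t ω) (v t ω i)‖ ^ 2 ∂P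
      = ∫ ω, FedAvgP.gradSq F D m (u t ω, v t ω) ∂P := by
    intro t ht
    have ht' := Finset.mem_range.1 ht
    simp only [FedAvgP.gradSq]
    rw [integral_add (hU t ht') ((integrable_finsetSum _ fun i _ => hVi t ht' i).const_mul _),
      integral_const_mul, integral_finsetSum _ fun i _ => hVi t ht' i]
  rw [Finset.sum_congr rfl hsplit]
  refine FedAvgP.rate_le hL0 hK0 hT0 hF₀_pos hV hγ (hsum.trans_eq ?_)
  rw [hF₀, FedAvgP.initialGap, FedAvgP.varianceTerm]
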